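/- **Conventions.** Fix $k\ge 1$. Deterministic algorithms that generate strings (programs and generators) are $k$-tape Turing machines with an arbitrary finite tape alphabet; the input is written on the first tape, and the output is the string found at the beginning of the first tape on halting. Fix a universal machine $U$ for these machines: every program $\Pi\in\{0,1\}^*$ is either invalid or encodes a pair $(M,w)$ of a $k$-tape machine and an input $w\in\{0,1\}^*$, every pair is encoded, and for each $M$ there is a constant $c_M$ such that every $(M,w)$ has an encoding of length at most $|w|+c_M$. Write $U(\Pi,1^s)=x$ if $\Pi$ encodes $(M,w)$ and $M(w)$ halts within $s$ steps with output $x$. For $t:\mathbb N\to[0,\infty)$ let $K^t(x)=\min\{|\Pi| : U(\Pi,1^{\lfloor t(|x|)\rfloor})=x\}$. A PPT algorithm is a probabilistic polynomial-time Turing machine (with any number of tapes) that tosses fair coins. All logarithms are to base $2$, $\mathcal U_n$ is the uniform distribution on $\{0,1\}^n$, $H$ is Shannon entropy, and "$n+\gamma\log n$" as a length means $n+\lfloor\gamma\log n\rfloor$. **Definitions.** Ensembles $\{A_n\},\{B_n\}$ are *$\mu$-indistinguishable* if for every probabilistic machine $D$ whose running time is polynomial in the length of its first input, $|\Pr[D(1^n,A_n)=1]-\Pr[D(1^n,B_n)=1]|<\mu(n)$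 for all sufficiently large $n$. A polynomial-time computable function $G:\{0,1\}^n\to\{0,1\}^{n+\gamma\log n}$ (for all $n$) is a *$\mu$-conditionally secure entropy-preserving PRG ($\mu$-condEP-PRG)* if there are non-empty events $E_n\subseteq\{0,1\}^n$ and a constant $\alpha$ such that $\{G(\mathcal U_n\mid E_n)\}_n$ and $\{\mathcal U_{n+\gamma\log n}\}_n$ are $\mu$-indistinguishable and $H(G(\mathcal U_n\mid E_n))\ge n-\alpha\log n$ for all sufficiently large $n$. It is *rate-1 efficient* if it is computed by a $k$-tape machine whose running time on inputs of length $n$ is at most $n+O(n^{a})$ for some constant $a<1$. A function $f:\{0,1\}^*\to\mathbb N$ is *mildly hard-on-average to $\beta(\cdot)$-approximate* if there is a polynomial $p>0$ such that for every PPT algorithm $\mathcal H$ and all sufficiently large $n$, $$\Pr\big[x\leftarrow\{0,1\}^n:\ |\mathcal H(x)-f(x)|\le\beta(n)\big]<1-\frac1{p(n)},$$ where the probability is also over the coins of $\mathcal H$ and the output of $\mathcal H$ is read as a number in binary. **Theorem.** Suppose that for every rational $\gamma>1$ there is a rate-1 efficient $\mu$-condEP-PRG $G:\{0,1\}^n\to\{0,1\}^{n+\gamma\log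 n}$ with $\mu(n)=1/n^2$. Then for all constants $d>0$, $\varepsilon>0$ and every polynomial $t$ (with real coefficients) such that $t(n)\ge(1+\varepsilon)n$ for all $n\in\mathbb N$, the function $K^t$ is mildly hard-on-average to $(d\log n)$-approximate. -/

import Mathlib

namespace CondEP

/-! ### Turing machines -/

/-- Head moves. Tapes are infinite to the right only; a left move in cell `0` leaves the head there. -/
inductive Move where
  | left : Move
  | stay : Move
  | right : Move

def Move.apply : Move → ℕ → ℕ
  | .left, i => i - 1
  | .stay, i => i
  | .right, i => i + 1

/-- Tape symbols: the blank `none`, the two bits, and `g` auxiliary symbols. -/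
abbrev Sym (g : ℕ) : Type := Option (Bool ⊕ Fin g)

/-- A Turing machine with `k + 1` tapes (tape `0` holds the input and the output, the others are
work tapes). The states are `0, …, q`, where `0` is initial and `q` is halting. In each step the
machine receives an element of `C`: deterministic machines have `C = Unit`, and probabilistic
machines, which toss one fair coin per step, have `C = Bool`. -/
structure TM (C : Type) (k : ℕ) where
  q : ℕ
  g : ℕ
  δ : Fin (q + 1) → C → (Fin (k + 1) → Sym g) → Fin (q + 1) × (Fin (k + 1) → Sym g × Move)

namespace TM

variable {C : Type} {k : ℕ}

structure Cfg (M : TM C k) where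
  state : Fin (M.q + 1)
  tape : Fin (k + 1) → ℕ → Sym M.g
  head : Fin (k + 1) → ℕ

/-- The initial configuration: `x` stands in the first cells of tape `0`, everything else is blank,
and all heads are in cell `0`. -/
def init (M : TM C k) (x : List Bool) : M.Cfg where
  state := 0
  tape i j := if i = 0 then (x[j]?).map Sum.inl else none
  head _ := 0

def Cfg.Halted {M : TM C k} (s : M.Cfg) : Prop := s.state = Fin.last M.q

/-- One step of the computation; a halted configuration does not change any more. -/
def step (M : TM C k) (c : C) (s : M.Cfg) : M.Cfg :=
  if s.state = Fin.last M.q then s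
  else
    let a := M.δ s.state c (fun i => s.tape i (s.head i))
    { state := a.1
      tape := fun i => Function.update (s.tape i) (s.head i) (a.2 i).1
      head := fun i => (a.2 i).2.apply (s.head i) }

/-- The configuration reached from the input `x` after `t` steps, where the `i`-th step receives
`ρ i`. -/
def run (M : TM C k) (ρ : ℕ → C) (x : List Bool) : ℕ → M.Cfg
  | 0 => M.init x
  | t + 1 => M.step (ρ t) (M.run ρ x t)

/-- The bit written in a cell, if there is one. -/
def bitOf {g : ℕ} : Sym g → Option Bool
  | some (Sum.inl b) => some b
  | _ => none

/-- `y` is the string of bits written on tape `0` from cell `0` up to the first cell that does not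
contain a bit. -/
def Cfg.Reads {M : TM C k} (s : M.Cfg) (y : List Bool) : Prop :=
  ∀ i ≤ y.length, bitOf (s.tape 0 i) = y[i]?

/-- On input `x` (and with `ρ` fed to the steps) the machine halts within `t` steps and its output
is `y`. -/
def Outputs (M : TM C k) (ρ : ℕ → C) (x : List Bool) (t : ℕ) (y : List Bool) : Prop :=
  (M.run ρ x t).Halted ∧ (M.run ρ x t).Reads y

/-- The deterministic machine `M` outputs `y` on input `x` within `t` steps. -/
def Computes (M : TM Unit k) (x : List Bool) (t : ℕ) (y : List Bool) : Prop :=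
  M.Outputs (fun _ => ()) x t y

end TM

/-! ### Time-bounded Kolmogorov complexity -/

/-- How a universal machine `U` reads its programs: a program `p` is an encoding of a pair `(M, w)`
of a `(k + 1)`-tape machine and an input (or is invalid). Every pair has an encoding, whose
length exceeds `|w|` only by a constant that depends on `M`. -/
structure DescriptionSystem (k : ℕ) where
  decode : List Bool → Option (TM Unit k × List Bool)
  universal : ∀ M : TM Unit k, ∃ c : ℕ, ∀ w : List Bool, ∃ p : List Bool,
    decode p = some (M, w) ∧ p.length ≤ w.length + c

/-- `U(p, 1^t) = x`: the program `p` encodes a pair `(M, w)`, and `M(w)`, emulated for `t` steps,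
outputs `x`. -/
def DescriptionSystem.Emulates {k : ℕ} (U : DescriptionSystem k) (p : List Bool) (t : ℕ)
    (x : List Bool) : Prop :=
  ∃ (M : TM Unit k) (w : List Bool), U.decode p = some (M, w) ∧ M.Computes w t x

/-- `K^t(x)`, the least length of a program `p` with `U(p, 1^{t(|x|)}) = x`. -/
noncomputable def DescriptionSystem.K {k : ℕ} (U : DescriptionSystem k) (t : ℕ → ℕ)
    (x : List Bool) : ℕ :=
  sInf {l : ℕ | ∃ p : List Bool, p.length = l ∧ U.Emulates p (t x.length) x}

/-- The minimum in the definition of `K^t` is attained for every `t` and `x`: the machine that halts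
at once outputs its input. -/
theorem DescriptionSystem.K_attained {k : ℕ} (U : DescriptionSystem k) (t : ℕ → ℕ)
    (x : List Bool) :
    ∃ p : List Bool, p.length = U.K t x ∧ U.Emulates p (t x.length) x := by
  have hne : {l : ℕ | ∃ p : List Bool, p.length = l ∧ U.Emulates p (t x.length) x}.Nonempty := by
    let M : TM Unit k := ⟨0, 0, fun _ _ _ => (0, fun _ => (none, .stay))⟩
    obtain ⟨c, hc⟩ := U.universal M
    obtain ⟨p, hp, -⟩ := hc x
    have hrun : ∀ n, M.run (fun _ => ()) x n = M.init x := by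
      intro n
      induction n with
      | zero => rfl
      | succ n ih =>
        simp only [TM.run, ih, TM.step]
        exact if_pos (Subsingleton.elim (α := Fin 1) _ _)
    refine ⟨_, p, rfl, M, x, hp, ?_, ?_⟩
    · exact Subsingleton.elim (α := Fin 1) _ _
    · intro i _
      rw [hrun]
      simp only [TM.init, if_true]
      cases x[i]? <;> rfl
  exact Nat.sInf_mem hne

instance : Encodable Move :=
  Encodable.ofLeftInjection
    (fun m : Move => match m with | .left => (0 : ℕ) | .stay => 1 | .right => 2)
    (fun n => match n with | 0 => some .left | 1 => some .stay | _ => some .right)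
    (fun m => by cases m <;> rfl)

/-- An effective enumeration of the deterministic machines, through their transition tables. -/
instance (k : ℕ) : Encodable (TM Unit k) :=
  letI (g : ℕ) : Fintype (Fin (k + 1) → Sym g) := Pi.instFintype
  letI (g : ℕ) : Encodable (Fin (k + 1) → Sym g) := Encodable.finArrow
  letI (q g : ℕ) : Encodable ((Fin (k + 1) → Sym g) →
      Fin (q + 1) × (Fin (k + 1) → Sym g × Move)) := Encodable.fintypeArrowOfEncodable
  Encodable.ofLeftInjection
    (α := Σ q : ℕ, Σ g : ℕ, Fin (q + 1) → (Fin (k + 1) → Sym g) →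
      Fin (q + 1) × (Fin (k + 1) → Sym g × Move))
    (fun M => ⟨M.q, M.g, fun i => M.δ i ()⟩) (fun s => some ⟨s.1, s.2.1, fun i _ => s.2.2 i⟩)
    (fun _ => rfl)

/-- The textbook description system, in which `1^i 0 w` encodes the `i`-th machine together with the
input `w`. -/
def DescriptionSystem.standard (k : ℕ) : DescriptionSystem k where
  decode p :=
    (Encodable.decode (p.takeWhile id).length).map
      fun M => (M, (p.dropWhile id).tail)
  universal M := by
    refine ⟨Encodable.encode M + 1, fun w =>
      ⟨List.replicate (Encodable.encode M) true ++ false :: w, ?_, ?_⟩⟩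
    · have h1 : ∀ n : ℕ, (List.replicate n true ++ false :: w).takeWhile id
          = List.replicate n true := by
        intro n; induction n with
        | zero => rfl
        | succ n ih => simp [List.replicate_succ, ih]
      have h2 : ∀ n : ℕ, (List.replicate n true ++ false :: w).dropWhile id = false :: w := by
        intro n; induction n with
        | zero => rfl
        | succ n ih => simp [List.replicate_succ, ih]
      simp [h1, h2]
    · simp; omega

/-! ### Probabilistic polynomial time and average-case hardness -/

/-- The probability of an event over `T` independent fair coins; only the first `T` entries of the
sequence passed to `P` are random. -/
noncomputable def coinProb (T : ℕ) (P : (ℕ → Bool) → Prop) : ℝ :=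
  (Nat.card {r : Fin T → Bool // P (fun i => if h : i < T then r ⟨i, h⟩ else false)} : ℝ) / 2 ^ T

/-- The number that a bit string denotes in binary, least significant bit first. -/
def binVal (y : List Bool) : ℕ := Nat.ofDigits 2 (y.map Bool.toNat)

/-- For all coin tosses, `H` halts on every input `x` within `T(|x|)` steps. -/
def RunsInTime {k : ℕ} (H : TM Bool k) (T : Polynomial ℕ) : Prop :=
  ∀ (x : List Bool) (ρ : ℕ → Bool), (H.run ρ x (T.eval x.length)).Halted

/-- The probability, over uniform `x ∈ {0,1}^n` and the coins of `H`, that `|H(x) - f(x)| ≤ b`. -/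
noncomputable def approxProb {k : ℕ} (H : TM Bool k) (T : Polynomial ℕ) (f : List Bool → ℕ)
    (b : ℝ) (n : ℕ) : ℝ :=
  (∑ x : Fin n → Bool, coinProb (T.eval n) (fun ρ => ∃ y : List Bool,
      H.Outputs ρ (List.ofFn x) (T.eval n) y ∧
        |(binVal y : ℝ) - (f (List.ofFn x) : ℝ)| ≤ b)) / 2 ^ n

/-- `f` is `α`-hard-on-average to `β`-approximate. -/
def HoAToApprox (f : List Bool → ℕ) (α β : ℕ → ℝ) : Prop :=
  ∀ (k : ℕ) (H : TM Bool k) (T : Polynomial ℕ), RunsInTime H T →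
    ∃ N : ℕ, ∀ n ≥ N, approxProb H T f (β n) n < 1 - α n

/-- `f` is mildly hard-on-average to `β`-approximate. -/
def MildlyHoAToApprox (f : List Bool → ℕ) (β : ℕ → ℝ) : Prop :=
  ∃ p : Polynomial ℝ, (∀ n : ℕ, 0 < p.eval (n : ℝ)) ∧
    HoAToApprox f (fun n => 1 / p.eval (n : ℝ)) β

/-! ### Conditionally secure entropy-preserving pseudorandom generators -/

/-- The input `(1^n, y)` of a distinguisher, written as the string `1^n 0 y`. -/
def pairInput (n : ℕ) (y : List Bool) : List Bool := List.replicate n true ++ false :: y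

/-- The running time of `D` on an input `(1^n, y)` is at most `T(n)`, for all coin tosses. -/
def RunsInTimeFirst {k : ℕ} (D : TM Bool k) (T : Polynomial ℕ) : Prop :=
  ∀ (n : ℕ) (y : List Bool) (ρ : ℕ → Bool), (D.run ρ (pairInput n y) (T.eval n)).Halted

/-- `Pr[D(1^n, A) = 1]` for a random variable with law `A` on `{0,1}^m`. -/
noncomputable def acceptProb {k m : ℕ} (D : TM Bool k) (T : Polynomial ℕ) (n : ℕ)
    (A : PMF (Fin m → Bool)) : ℝ :=
  ∑ y : Fin m → Bool, (A y).toReal * coinProb (T.eval n) (fun ρ =>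
    D.Outputs ρ (pairInput n (List.ofFn y)) (T.eval n) [true])

/-- The ensembles `A` and `B` are `μ`-indistinguishable. -/
def Indistinguishable {m : ℕ → ℕ} (μ : ℕ → ℝ) (A B : (n : ℕ) → PMF (Fin (m n) → Bool)) : Prop :=
  ∀ (k : ℕ) (D : TM Bool k) (T : Polynomial ℕ), RunsInTimeFirst D T →
    ∃ N : ℕ, ∀ n ≥ N, |acceptProb D T n (A n) - acceptProb D T n (B n)| < μ n

/-- Shannon entropy, in bits. -/
noncomputable def entropy {V : Type} [Fintype V] (X : PMF V) : ℝ :=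
  ∑ v : V, (X v).toReal * Real.logb 2 (1 / (X v).toReal)

/-- `n + γ log n`, with the second summand rounded down to an integer. -/
noncomputable def outLen (γ : ℝ) (n : ℕ) : ℕ := n + ⌊γ * Real.logb 2 n⌋₊

/-- The machine `M` computes `G` on inputs of length `n` within `T n` steps. -/
def ComputesInTime {k : ℕ} {m : ℕ → ℕ} (M : TM Unit k)
    (G : (n : ℕ) → (Fin n → Bool) → (Fin (m n) → Bool)) (T : ℕ → ℕ) : Prop :=
  ∀ (n : ℕ) (s : Fin n → Bool), M.Computes (List.ofFn s) (T n) (List.ofFn (G n s))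

/-- `G` is computable in polynomial time. -/
def EfficientlyComputable {m : ℕ → ℕ}
    (G : (n : ℕ) → (Fin n → Bool) → (Fin (m n) → Bool)) : Prop :=
  ∃ (k : ℕ) (M : TM Unit k) (T : Polynomial ℕ), ComputesInTime M G (fun n => T.eval n)

/-- Rate-1 efficiency on `(k + 1)`-tape machines: the running time is `n + O(n^a)` for some
constant `a < 1`. -/
def RateOneEfficient (k : ℕ) {m : ℕ → ℕ}
    (G : (n : ℕ) → (Fin n → Bool) → (Fin (m n) → Bool)) : Prop :=
  ∃ (M : TM Unit k) (T : ℕ → ℕ), ComputesInTime M G T ∧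
    ∃ C a : ℝ, a < 1 ∧ ∀ n ≥ 1, (T n : ℝ) ≤ n + C * (n : ℝ) ^ a

/-- `G : {0,1}^n → {0,1}^{n + γ log n}` is a `μ`-conditionally secure entropy-preserving
pseudorandom generator. Here `(PMF.uniformOfFinset (E n) (hE n)).map (G n)` is the law of
`G(U_n | E_n)`. -/
def IsCondEPPRG (μ : ℕ → ℝ) (γ : ℝ)
    (G : (n : ℕ) → (Fin n → Bool) → (Fin (outLen γ n) → Bool)) : Prop :=
  EfficientlyComputable G ∧
  ∃ (E : (n : ℕ) → Finset (Fin n → Bool)) (hE : ∀ n, (E n).Nonempty) (α : ℝ),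
    Indistinguishable μ (fun n => (PMF.uniformOfFinset (E n) (hE n)).map (G n))
        (fun n => PMF.uniformOfFintype (Fin (outLen γ n) → Bool)) ∧
    ∃ N : ℕ, ∀ n ≥ N,
      (n : ℝ) - α * Real.logb 2 n ≤ entropy ((PMF.uniformOfFinset (E n) (hE n)).map (G n))

end CondEP

/-! An approximator of `K^t` that errs too rarely breaks the generator. Let m = n + γ log n,
rounded, be an output length. A string G(s) has the description (M, s), and M halts within n +
O(n^a) ≤ (1 + ε)m ≤ t(m) steps, so its complexity is at most n + c. All but an eighth of the strings
of length m have complexity at least m - c. If γ is large compared with d, these values lie more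
than 2d log m apart, and comparing H(y) with about (n + m)/2 separates them wherever H is accurate
to within d log m.

H is accurate only on average over uniform y, whereas the distinguisher must also succeed on X =
G(U_n | E_n). Entropy bridges this. If H fails with probability at most 1/P, then the set S of
strings on which it succeeds with probability below 1/2 has at most 2·2^m/P elements. For P a large
power of m this is far below 2^n. Since X takes at most 2^n values, putting mass above 1/2 on S
would cost it more than α log n bits of entropy (`entropy_le_of_split`). Hence X is accepted with
probability at least 1/4 and a uniform string with probability at most 3/16 (`advantage`,
`accept_gap`). The exponent of P depends only on γ and α, so one polynomial serves all H.

Two points need care. The distinguisher must be an actual machine with running time polynomial in n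
alone; `exists_threshold_machine` builds it. And n + ⌊γ log n⌋ skips some lengths, whereas hardness
is claimed for all large m; `exists_outLen` shows that the stretches γ and 2γ together miss only
finitely many. -/

namespace CondEP

/-! ### Runs, halting and output of Turing machines -/

namespace TM

variable {C : Type} {k : ℕ}

/-- The configuration reached from `s` after `t` steps. -/
def runFrom (M : TM C k) (ρ : ℕ → C) (s : M.Cfg) : ℕ → M.Cfg
  | 0 => s
  | t + 1 => M.step (ρ t) (runFrom M ρ s t)

theorem run_eq_runFrom (M : TM C k) (ρ : ℕ → C) (x : List Bool) (t : ℕ) :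
    M.run ρ x t = M.runFrom ρ (M.init x) t := by
  induction t with
  | zero => rfl
  | succ t ih => simp only [run, runFrom, ih]

theorem runFrom_add (M : TM C k) (ρ : ℕ → C) (s : M.Cfg) (a b : ℕ) :
    M.runFrom ρ s (a + b) = M.runFrom (fun i => ρ (a + i)) (M.runFrom ρ s a) b := by
  induction b with
  | zero => rfl
  | succ b ih =>
    change M.step (ρ (a + b)) (M.runFrom ρ s (a + b)) = _
    rw [ih]
    rfl

theorem step_of_halted {M : TM C k} {s : M.Cfg} (h : s.Halted) (c : C) : M.step c s = s :=
  if_pos h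

theorem runFrom_of_halted {M : TM C k} {s : M.Cfg} (h : s.Halted) (ρ : ℕ → C) (t : ℕ) :
    M.runFrom ρ s t = s := by
  induction t with
  | zero => rfl
  | succ t ih => rw [runFrom, ih, step_of_halted h]

theorem run_eq_of_halted {M : TM C k} {ρ : ℕ → C} {x : List Bool} {t u : ℕ}
    (h : (M.run ρ x t).Halted) (htu : t ≤ u) : M.run ρ x u = M.run ρ x t := by
  obtain ⟨b, rfl⟩ := Nat.exists_eq_add_of_le htu
  rw [run_eq_runFrom] at h
  rw [run_eq_runFrom, runFrom_add, runFrom_of_halted h, run_eq_runFrom]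

theorem Outputs.mono {M : TM C k} {ρ : ℕ → C} {x y : List Bool} {t u : ℕ}
    (h : M.Outputs ρ x t y) (htu : t ≤ u) : M.Outputs ρ x u y := by
  rw [Outputs, run_eq_of_halted h.1 htu]
  exact h

theorem run_congr (M : TM C k) {ρ σ : ℕ → C} (x : List Bool) {t : ℕ}
    (h : ∀ i < t, ρ i = σ i) : M.run ρ x t = M.run σ x t := by
  induction t with
  | zero => rfl
  | succ t ih => rw [run, run, ih fun i hi => h i (hi.trans t.lt_succ_self), h t t.lt_succ_self]

theorem outputs_congr (M : TM C k) {ρ σ : ℕ → C} (x : List Bool) {t : ℕ}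
    (h : ∀ i < t, ρ i = σ i) (y : List Bool) : M.Outputs ρ x t y ↔ M.Outputs σ x t y := by
  rw [Outputs, Outputs, run_congr M x h]

theorem Cfg.Reads.unique {M : TM C k} {s : M.Cfg} {y z : List Bool} (hy : s.Reads y)
    (hz : s.Reads z) : y = z := by
  have key : ∀ y z : List Bool, s.Reads y → s.Reads z → z.length ≤ y.length := by
    intro y z hy hz
    by_contra! hlt
    have h1 := hy y.length le_rfl
    have h2 := hz y.length hlt.le
    rw [h1] at h2
    simp [hlt] at h2
  have hl : y.length = z.length := le_antisymm (key z y hz hy) (key y z hy hz)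
  apply List.ext_getElem?
  intro i
  by_cases hi : i ≤ y.length
  · rw [← hy i hi, hz i (hl ▸ hi)]
  · rw [List.getElem?_eq_none (by omega), List.getElem?_eq_none (by omega)]

theorem Outputs.unique {M : TM C k} {ρ : ℕ → C} {x y z : List Bool} {t : ℕ}
    (hy : M.Outputs ρ x t y) (hz : M.Outputs ρ x t z) : y = z :=
  hy.2.unique hz.2

theorem _root_.CondEP.Move.apply_le (m : Move) (i : ℕ) : m.apply i ≤ i + 1 := by
  cases m <;> simp only [Move.apply] <;> omega

theorem head_run_le (M : TM C k) (ρ : ℕ → C) (x : List Bool) (t : ℕ) (i : Fin (k + 1)) :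
    (M.run ρ x t).head i ≤ t := by
  induction t with
  | zero => exact le_rfl
  | succ t ih =>
    rw [run, step]
    split
    · omega
    · exact (Move.apply_le _ _).trans (Nat.succ_le_succ ih)

theorem tape_run_eq_none (M : TM C k) (ρ : ℕ → C) (x : List Bool) (t : ℕ) (i : Fin (k + 1))
    {j : ℕ} (hj : x.length + t ≤ j) : (M.run ρ x t).tape i j = none := by
  induction t with
  | zero =>
    simp only [run, init]
    rw [List.getElem?_eq_none (by omega)]
    simp
  | succ t ih =>
    have hh := head_run_le M ρ x t i
    rw [run, step]
    split
    · exact ih (by omega)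
    · simp only
      rw [Function.update_of_ne (by omega), ih (by omega)]

end TM

/-- From cell `p` on, the tape `Z` carries the bits of `z`, followed by something else. -/
def ReadsFrom {g : ℕ} (Z : ℕ → Sym g) (p : ℕ) (z : List Bool) : Prop :=
  ∀ i ≤ z.length, TM.bitOf (Z (p + i)) = z[i]?

/-- Gives every configuration of a run an output: only finitely many cells have been touched, so the
bits stop somewhere. -/
theorem exists_list_of_eq_none (f : ℕ → Option Bool) {j : ℕ} (hj : f j = none) :
    ∃ z : List Bool, z.length ≤ j ∧ ∀ i ≤ z.length, f i = z[i]? := by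
  induction j generalizing f with
  | zero => exact ⟨[], by simp, by simpa using hj⟩
  | succ j ih =>
    obtain ⟨z, hz, h⟩ := ih (fun i => f (i + 1)) hj
    cases hb : f 0 with
    | none => exact ⟨[], by simp, by simpa using hb⟩
    | some b =>
      refine ⟨b :: z, by simpa using hz, fun i hi => ?_⟩
      cases i with
      | zero => simpa using hb
      | succ i => simpa using h i (by simpa using hi)

theorem TM.exists_reads {C : Type} {k : ℕ} (M : TM C k) (ρ : ℕ → C) (x : List Bool) (t : ℕ) :
    ∃ z : List Bool, z.length ≤ x.length + t ∧ (M.run ρ x t).Reads z :=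
  exists_list_of_eq_none (fun i => bitOf ((M.run ρ x t).tape 0 i))
    (j := x.length + t) (by simp [tape_run_eq_none, bitOf])


/-! ### A machine that compares the output of another machine with a threshold -/

/-- The control states of the threshold machine outside the simulation: read the unary number
(two steps per symbol), copy the string, return to the start of the copy, use up two cells of the
counter, subtract one from the simulated output, and accept. -/
inductive Phase where
  | start | ones | ones' | copy | count | count' | pred | accept | halt
  | rewind (first : Bool)
  deriving Fintype, DecidableEq

/-- The control states of the threshold machine for a machine with states `0, …, q`. -/
abbrev Ctl (q : ℕ) : Type := Phase ⊕ Fin (q + 1)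

/-- Allows control states to come from any finite type: two transpositions bring the start and
halting states to the positions that the machine model prescribes. -/
theorem exists_equiv_fin {Q : Type} [Fintype Q] [DecidableEq Q] {a b : Q} (hab : a ≠ b) :
    ∃ (q : ℕ) (e : Q ≃ Fin (q + 1)), e a = 0 ∧ e b = Fin.last q := by
  obtain ⟨q, hq⟩ : ∃ q, Fintype.card Q = q + 1 :=
    Nat.exists_eq_succ_of_ne_zero (haveI : Nonempty Q := ⟨a⟩; Fintype.card_ne_zero)
  let e₀ : Q ≃ Fin (q + 1) := Fintype.equivFinOfCardEq hq
  let e₁ : Q ≃ Fin (q + 1) := e₀.trans (Equiv.swap (e₀ a) 0)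
  have h1 : e₁ a = 0 := by simp [e₁]
  have h2 : (0 : Fin (q + 1)) ≠ e₁ b := by
    rw [← h1]
    exact e₁.injective.ne hab
  have h3 : (0 : Fin (q + 1)) ≠ Fin.last q := by
    intro h
    have hq0 : q = 0 := by simpa using (congrArg Fin.val h).symm
    subst hq0
    exact h2 (Subsingleton.elim (α := Fin 1) _ _)
  refine ⟨q, e₁.trans (Equiv.swap (e₁ b) (Fin.last q)), ?_, ?_⟩
  · rw [Equiv.trans_apply, h1, Equiv.swap_apply_of_ne_of_ne h2 h3]
  · simp

/-- The action of the threshold machine in one step: the next control state, what happens on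
tape `0`, the moves on the two marked tapes, and what happens on the simulated tapes. -/
structure Act (q g k : ℕ) where
  next : Ctl q
  input : Sym g × Move
  moveA : Move
  moveB : Move
  sim : Fin (k + 1) → Sym g × Move

section Machine

variable {k : ℕ} (H : TM Bool k)

/-- The symbol for a bit. -/
abbrev bit {g : ℕ} (b : Bool) : Sym g := some (Sum.inl b)

/-- Write `w` on the first simulated tape and move `m` there. -/
def onFirst {g : ℕ} (r : Fin (k + 1) → Sym g) (w : Sym g) (m : Move) :
    Fin (k + 1) → Sym g × Move :=
  fun i => if i = 0 then (w, m) else (r i, .stay)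

/-- The transition table of the threshold machine. The arguments are the control state, the coin
and the symbols read. -/
def act : Ctl H.q → Bool → Sym H.g → Sym H.g → Sym H.g → (Fin (k + 1) → Sym H.g) →
    Act H.q H.g k
  | .inl .start, _, r, _, _, rs =>
    if r = bit true then ⟨.inl .ones, (bit false, .right), .stay, .right, onFirst rs (rs 0) .stay⟩
    else ⟨.inl .halt, (r, .stay), .stay, .stay, onFirst rs (rs 0) .stay⟩
  | .inl .ones, _, r, _, _, rs =>
    if r = bit true then ⟨.inl .ones', (r, .stay), .stay, .right, onFirst rs (rs 0) .stay⟩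
    else ⟨.inl .copy, (bit true, .right), .stay, .stay, onFirst rs (rs 0) .stay⟩
  | .inl .ones', _, _, _, _, rs =>
    ⟨.inl .ones, (bit true, .right), .stay, .right, onFirst rs (rs 0) .stay⟩
  | .inl .copy, _, r, _, rB, rs =>
    if r = none then
      ⟨.inl (.rewind true), (bit true, .stay), .stay, .stay, onFirst rs (rs 0) .stay⟩
    else if rB = none then
      ⟨.inl .copy, (bit true, .right), .right, .left, onFirst rs r .right⟩
    else ⟨.inl .halt, (r, .stay), .stay, .stay, onFirst rs (rs 0) .stay⟩
  | .inl (.rewind first), _, r, rA, _, rs =>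
    if rA = none then
      ⟨.inl (.rewind first), (r, .stay), .left, .stay, onFirst rs (rs 0) .left⟩
    else
      ⟨if first then .inr 0 else .inl .count, (r, .stay), .stay, .stay, onFirst rs (rs 0) .stay⟩
  | .inr s, c, r, _, _, rs =>
    if s = Fin.last H.q then
      ⟨.inl (.rewind false), (r, .stay), .stay, .stay, onFirst rs (rs 0) .stay⟩
    else ⟨.inr (H.δ s c rs).1, (r, .stay), ((H.δ s c rs).2 0).2, .stay, (H.δ s c rs).2⟩
  | .inl .count, _, r, _, _, rs =>
    if r = bit false then ⟨.inl .halt, (r, .stay), .stay, .stay, onFirst rs (rs 0) .stay⟩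
    else ⟨.inl .count', (none, .left), .stay, .stay, onFirst rs (rs 0) .stay⟩
  | .inl .count', _, r, _, _, rs =>
    if r = bit false then ⟨.inl .halt, (r, .stay), .stay, .stay, onFirst rs (rs 0) .stay⟩
    else ⟨.inl .pred, (none, .left), .stay, .stay, onFirst rs (rs 0) .stay⟩
  | .inl .pred, _, r, _, _, rs =>
    match TM.bitOf (rs 0) with
    | some false => ⟨.inl .pred, (r, .stay), .right, .stay, onFirst rs (bit true) .right⟩
    | some true => ⟨.inl (.rewind false), (r, .stay), .stay, .stay, onFirst rs (bit false) .stay⟩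
    | none => ⟨.inl .accept, (r, .stay), .stay, .stay, onFirst rs (rs 0) .stay⟩
  | .inl .accept, _, r, _, _, rs =>
    if r = bit false then ⟨.inl .halt, (bit true, .stay), .stay, .stay, onFirst rs (rs 0) .stay⟩
    else ⟨.inl .accept, (none, .left), .stay, .stay, onFirst rs (rs 0) .stay⟩
  | .inl .halt, _, r, _, _, rs =>
    ⟨.inl .halt, (r, .stay), .stay, .stay, onFirst rs (rs 0) .stay⟩

/-- The tape with a mark in cell `0`. -/
def mark {g : ℕ} : ℕ → Sym g := fun j => if j = 0 then bit true else none

variable {q : ℕ} (e : Ctl H.q ≃ Fin (q + 1))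

/-- The machine that simulates `H` on the second component of its input and compares the output
with half of the input length. Tape `0` holds the input, the next two tapes carry a mark in
cell `0`, which is written in the first step, and the others are the tapes of `H`. -/
def thresholdTM : TM Bool (k + 3) where
  q := q
  g := H.g
  δ s c r :=
    let o := act H (e.symm s) c (r 0) (r (Fin.succ 0)) (r (Fin.succ (Fin.succ 0)))
      (fun i => r i.succ.succ.succ)
    let w := fun x : Sym H.g => if e.symm s = .inl .start then bit true else x
    (e o.next, Matrix.vecCons o.input (Matrix.vecCons (w (r (Fin.succ 0)), o.moveA)
      (Matrix.vecCons (w (r (Fin.succ (Fin.succ 0))), o.moveB) o.sim)))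

/-- The configurations of the threshold machine after the first step. -/
def conf (s : Ctl H.q) (T : ℕ → Sym H.g) (p a b : ℕ) (R : Fin (k + 1) → ℕ → Sym H.g)
    (h : Fin (k + 1) → ℕ) : (thresholdTM H e).Cfg where
  state := e s
  tape := Matrix.vecCons T (Matrix.vecCons mark (Matrix.vecCons mark R))
  head := Matrix.vecCons p (Matrix.vecCons a (Matrix.vecCons b h))

variable {H e}

theorem step_conf (hl : e (.inl .halt) = Fin.last q) {s : Ctl H.q} (hs : s ≠ .inl .halt)
    (hs' : s ≠ .inl .start) (c : Bool) (T : ℕ → Sym H.g) (p a b : ℕ)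
    (R : Fin (k + 1) → ℕ → Sym H.g) (h : Fin (k + 1) → ℕ) {o : Act H.q H.g k}
    (ho : act H s c (T p) (mark a) (mark b) (fun i => R i (h i)) = o) :
    (thresholdTM H e).step c (conf H e s T p a b R h) =
      conf H e o.next (Function.update T p o.input.1) (o.input.2.apply p) (o.moveA.apply a)
        (o.moveB.apply b) (fun i => Function.update (R i) (h i) (o.sim i).1)
        (fun i => (o.sim i).2.apply (h i)) := by
  have h1 : (conf H e s T p a b R h).state ≠ Fin.last (thresholdTM H e).q := by
    change e s ≠ Fin.last q
    rw [← hl]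
    exact e.injective.ne hs
  rw [TM.step, if_neg h1]
  subst ho
  simp only [thresholdTM, conf, Equiv.symm_apply_apply, if_neg hs']
  simp only [Matrix.cons_val_zero, Matrix.cons_val_succ, TM.Cfg.mk.injEq]
  refine ⟨trivial, ?_, ?_⟩ <;>
  · funext i
    refine Fin.cases ?_ (fun i => Fin.cases ?_ (fun i => Fin.cases ?_ (fun i => ?_) i) i) i <;>
    simp

end Machine

/-! ### The phases of the threshold machine -/

section Machine

/-- Whatever the coins, `t` steps lead from `s` to `s'`. -/
def TM.Reach {C : Type} {k : ℕ} (M : TM C k) (s : M.Cfg) (t : ℕ) (s' : M.Cfg) : Prop :=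
  ∀ ρ : ℕ → C, M.runFrom ρ s t = s'

theorem TM.Reach.trans {C : Type} {k : ℕ} {M : TM C k} {s s' s'' : M.Cfg} {t u : ℕ}
    (h : M.Reach s t s') (h' : M.Reach s' u s'') : M.Reach s (t + u) s'' := by
  intro ρ
  rw [runFrom_add, h, h']

theorem TM.Reach.refl {C : Type} {k : ℕ} {M : TM C k} (s : M.Cfg) : M.Reach s 0 s :=
  fun _ => rfl

theorem TM.Reach.single {C : Type} {k : ℕ} {M : TM C k} {s s' : M.Cfg}
    (h : ∀ c, M.step c s = s') : M.Reach s 1 s' := fun ρ => h (ρ 0)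

theorem TM.Reach.head {C : Type} {k : ℕ} {M : TM C k} {s s' s'' : M.Cfg} {t : ℕ}
    (h : ∀ c, M.step c s = s') (h' : M.Reach s' t s'') : M.Reach s (t + 1) s'' :=
  add_comm 1 t ▸ (TM.Reach.single h).trans h'

variable {k : ℕ} {H : TM Bool k} {q : ℕ} {e : Ctl H.q ≃ Fin (q + 1)}

variable (H e) in
/-- A configuration of the threshold machine in which the first simulated tape is `Z`, with the
head in cell `p`, and the first marked tape has its head in the same cell. -/
def zconf (R : Fin (k + 1) → ℕ → Sym H.g) (h : Fin (k + 1) → ℕ) (s : Ctl H.q)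
    (T : ℕ → Sym H.g) (P b : ℕ) (Z : ℕ → Sym H.g) (p : ℕ) : (thresholdTM H e).Cfg :=
  conf H e s T P p b (Function.update R 0 Z) (Function.update h 0 p)

variable {R : Fin (k + 1) → ℕ → Sym H.g} {h : Fin (k + 1) → ℕ}

/-- The move `m` is the same on the first marked tape and on the first simulated tape, so their
heads stay in the same cell. The mark thus reveals the left end of the simulated tape, which carries
no mark of its own. -/
theorem step_zconf (hl : e (.inl .halt) = Fin.last q) {s s' : Ctl H.q} {T : ℕ → Sym H.g}
    {P b : ℕ} {Z : ℕ → Sym H.g} {p : ℕ} {w₀ w : Sym H.g} {m₀ m mB : Move}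
    (hs : s ≠ .inl .halt) (hs' : s ≠ .inl .start) {c : Bool}
    (ho : ∀ rs : Fin (k + 1) → Sym H.g, rs 0 = Z p → act H s c (T P) (mark p) (mark b) rs
      = ⟨s', (w₀, m₀), m, mB, onFirst rs w m⟩) :
    (thresholdTM H e).step c (zconf H e R h s T P b Z p) =
      zconf H e R h s' (Function.update T P w₀) (m₀.apply P) (mB.apply b)
        (Function.update Z p w) (m.apply p) := by
  rw [zconf, step_conf hl hs hs' c T P p b _ _ (ho _ (by simp)), zconf]
  congr 1
  · funext i
    by_cases hi : i = 0
    · subst hi; simp [onFirst]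
    · simp [onFirst, hi]
  · funext i
    by_cases hi : i = 0
    · subst hi; simp [onFirst]
    · simp [onFirst, hi, Move.apply]

theorem mark_zero {g : ℕ} : (mark : ℕ → Sym g) 0 = bit true := rfl

theorem mark_succ {g : ℕ} (i : ℕ) : (mark : ℕ → Sym g) (i + 1) = none := rfl

/-- The tape `I` with its first `j` cells overwritten: `0` by `false` and the others by `true`. -/
def norm {g : ℕ} (I : ℕ → Sym g) (j : ℕ) : ℕ → Sym g :=
  fun i => if i = 0 then bit false else if i < j then bit true else I i

theorem norm_update_true {g : ℕ} (I : ℕ → Sym g) {j : ℕ} (hj : 1 ≤ j) :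
    Function.update (norm I j) j (bit true) = norm I (j + 1) := by
  funext i
  by_cases hi : i = j
  · subst hi; simp [norm]; omega
  · have : i < j + 1 ↔ i < j := by omega
    simp [norm, hi, this]

theorem norm_update_none {g : ℕ} {j : ℕ} (hj : 1 ≤ j) :
    Function.update (norm (fun _ => none : ℕ → Sym g) (j + 1)) j none
      = norm (fun _ => none) j := by
  funext i
  by_cases hi : i = j
  · subst hi; simp [norm]; omega
  · have : i < j + 1 ↔ i < j := by omega
    simp [norm, hi, this]

theorem norm_self {g : ℕ} (I : ℕ → Sym g) {j : ℕ} (hj : 1 ≤ j) : norm I j j = I j := by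
  simp [norm]; omega

theorem norm_lt {g : ℕ} (I : ℕ → Sym g) {i j : ℕ} (hi : 1 ≤ i) (hij : i < j) :
    norm I j i = bit true := by
  simp [norm, hij]; omega

theorem norm_zero {g : ℕ} (I : ℕ → Sym g) (j : ℕ) : norm I j 0 = bit false := rfl

theorem norm_update_zero {g : ℕ} (I : ℕ → Sym g) (j : ℕ) :
    Function.update (norm I j) 0 (bit false) = norm I j :=
  Function.update_eq_self_iff.2 rfl

/-- The tape with the bits of `l` in its first cells. -/
def listTape {g : ℕ} (l : List Bool) : ℕ → Sym g := fun j => (l[j]?).map Sum.inl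

theorem listTape_update {g : ℕ} (l : List Bool) (b : Bool) :
    Function.update (listTape l : ℕ → Sym g) l.length (bit b) = listTape (l ++ [b]) := by
  funext i
  by_cases hi : i = l.length
  · subst hi; simp [listTape]
  · rcases lt_or_gt_of_ne hi with hi' | hi'
    · simp [listTape, hi, List.getElem?_append_left hi']
    · simp only [listTape, ne_eq, hi, not_false_eq_true, Function.update_of_ne]
      rw [List.getElem?_eq_none (by omega), List.getElem?_eq_none (by simp; omega)]

theorem reach_rewind (hl : e (.inl .halt) = Fin.last q) (first : Bool) (T : ℕ → Sym H.g)
    (P b : ℕ) (Z : ℕ → Sym H.g) (p : ℕ) :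
    (thresholdTM H e).Reach (zconf H e R h (.inl (.rewind first)) T P b Z p) (p + 1)
      (zconf H e R h (if first then .inr 0 else .inl .count) T P b Z 0) := by
  induction p with
  | zero =>
    refine TM.Reach.single fun c => ?_
    rw [step_zconf (s' := if first then .inr 0 else .inl .count) (w₀ := T P) (w := Z 0)
      (m₀ := .stay) (m := .stay) (mB := .stay) hl (by simp) (by simp)
      (fun rs hrs => by simp [act, mark_zero, hrs])]
    simp [Move.apply]
  | succ p ih =>
    refine TM.Reach.head (fun c => ?_) ih
    rw [step_zconf (s' := .inl (.rewind first)) (w₀ := T P) (w := Z (p + 1))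
      (m₀ := .stay) (m := .left) (mB := .stay) hl (by simp) (by simp)
      (fun rs hrs => by simp [act, mark_succ, hrs])]
    simp [Move.apply]

theorem reach_accept (hl : e (.inl .halt) = Fin.last q) (P b : ℕ) (Z : ℕ → Sym H.g) (p : ℕ) :
    (thresholdTM H e).Reach
      (zconf H e R h (.inl .accept) (norm (fun _ => none) (P + 1)) P b Z p) (P + 1)
      (zconf H e R h (.inl .halt)
        (Function.update (norm (fun _ => none) 1) 0 (bit true)) 0 b Z p) := by
  induction P with
  | zero =>
    refine TM.Reach.single fun c => ?_
    rw [step_zconf (s' := .inl .halt) (w₀ := bit true) (w := Z p)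
      (m₀ := .stay) (m := .stay) (mB := .stay) hl (by simp) (by simp)
      (fun rs hrs => by simp [act, norm_zero, hrs])]
    simp [Move.apply]
  | succ P ih =>
    refine TM.Reach.head (fun c => ?_) ih
    rw [step_zconf (s' := .inl .accept) (w₀ := none) (w := Z p)
      (m₀ := .left) (m := .stay) (mB := .stay) hl (by simp) (by simp)
      (fun rs hrs => by simp [act, norm_lt, hrs]), norm_update_none (by omega)]
    simp [Move.apply]

/-- Binary decrement, least significant bit first: leading zeros become ones until the first one
becomes a zero. If there is no one, the number was zero and the head runs off its end. The length of
the numeral is kept, so the time bound is the same in every round. -/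
theorem reach_pred (hl : e (.inl .halt) = Fin.last q) (T : ℕ → Sym H.g) (P b : ℕ)
    (z : List Bool) (Z : ℕ → Sym H.g) (p : ℕ) (hz : ReadsFrom Z p z) :
    (binVal z = 0 ∧ ∃ (t : ℕ) (Z' : ℕ → Sym H.g) (p' : ℕ), t ≤ z.length + 1 ∧
      (thresholdTM H e).Reach (zconf H e R h (.inl .pred) T P b Z p) t
        (zconf H e R h (.inl .accept) T P b Z' p')) ∨
    ∃ (t : ℕ) (Z' : ℕ → Sym H.g) (p' : ℕ) (z' : List Bool), t ≤ z.length + 1 ∧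
      p' ≤ p + z.length ∧ z'.length = z.length ∧ binVal z' + 1 = binVal z ∧
      ReadsFrom Z' p z' ∧ (∀ i < p, Z' i = Z i) ∧
      (thresholdTM H e).Reach (zconf H e R h (.inl .pred) T P b Z p) t
        (zconf H e R h (.inl (.rewind false)) T P b Z' p') := by
  induction z generalizing Z p with
  | nil =>
    refine .inl ⟨rfl, 1, Z, p, by simp, TM.Reach.single fun c => ?_⟩
    have h0 : TM.bitOf (Z p) = none := by simpa using hz 0 le_rfl
    rw [step_zconf (s' := .inl .accept) (w₀ := T P) (w := Z p)
      (m₀ := .stay) (m := .stay) (mB := .stay) hl (by simp) (by simp)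
      (fun rs hrs => by simp [act, hrs, h0])]
    simp [Move.apply]
  | cons a z ih =>
    have h0 : TM.bitOf (Z p) = some a := by simpa using hz 0 (by simp)
    have hz' : ∀ w, ReadsFrom (Function.update Z p w) (p + 1) z := by
      intro w i hi
      rw [Function.update_of_ne (by omega)]
      have := hz (i + 1) (by simpa using hi)
      rw [← add_assoc, List.getElem?_cons_succ] at this
      rw [← this]
      congr 2
      omega
    have hcons : ∀ (Z' : ℕ → Sym H.g) (a' : Bool) (z' : List Bool), Z' p = bit a' →
        ReadsFrom Z' (p + 1) z' → ReadsFrom Z' p (a' :: z') := by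
      intro Z' a' z' h1 h2 i hi
      cases i with
      | zero => simp [h1, TM.bitOf]
      | succ i =>
        rw [List.getElem?_cons_succ, ← h2 i (by simpa using hi)]
        congr 2
        omega
    cases a with
    | true =>
      refine .inr ⟨1, Function.update Z p (bit false), p, false :: z, by simp, by omega, by simp,
        by simp [binVal, Nat.ofDigits_cons]; omega, hcons _ _ _ (by simp) (hz' _),
        fun i hi => Function.update_of_ne hi.ne _ _, TM.Reach.single fun c => ?_⟩
      rw [step_zconf (s' := .inl (.rewind false)) (w₀ := T P) (w := bit false)
        (m₀ := .stay) (m := .stay) (mB := .stay) hl (by simp) (by simp)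
        (fun rs hrs => by simp [act, hrs, h0])]
      simp [Move.apply]
    | false =>
      have h1 : (thresholdTM H e).Reach (zconf H e R h (.inl .pred) T P b Z p) 1
          (zconf H e R h (.inl .pred) T P b (Function.update Z p (bit true)) (p + 1)) := by
        refine TM.Reach.single fun c => ?_
        rw [step_zconf (s' := .inl .pred) (w₀ := T P) (w := bit true)
          (m₀ := .stay) (m := .right) (mB := .stay) hl (by simp) (by simp)
          (fun rs hrs => by simp [act, hrs, h0])]
        simp [Move.apply]
      rcases ih (Function.update Z p (bit true)) (p + 1) (hz' _) with
        ⟨hv, t, Z', p', ht, hr⟩ | ⟨t, Z', p', z', ht, hp', hlen, hv, hzz, hag, hr⟩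
      · refine .inl ⟨?_, 1 + t, Z', p', by simp; omega, h1.trans hr⟩
        simp only [binVal] at hv
        simp [binVal, Nat.ofDigits_cons, hv]
      · refine .inr ⟨1 + t, Z', p', true :: z', by simp; omega, by simp; omega, by simp [hlen], ?_,
          hcons _ _ _ (by rw [hag p (by omega)]; simp) hzz, fun i hi => ?_, h1.trans hr⟩
        · simp only [binVal] at hv
          simp [binVal, Nat.ofDigits_cons]
          omega
        · rw [hag i (by omega), Function.update_of_ne hi.ne]

theorem halted_zconf (hl : e (.inl .halt) = Fin.last q) (T : ℕ → Sym H.g) (P b : ℕ)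
    (Z : ℕ → Sym H.g) (p : ℕ) : (zconf H e R h (.inl .halt) T P b Z p).Halted := hl

/-- Each round erases two cells of the unary counter and then tries to subtract one. The failing
subtraction, which leads to acceptance, occurs in round `binVal z + 1`, whence the factor 2 and the
summand 1. Cell 0 keeps `false` until acceptance, so a rejecting run cannot read as `[true]`. -/
theorem reach_count (hl : e (.inl .halt) = Fin.last q) (b l P : ℕ) (Z : ℕ → Sym H.g) (p : ℕ)
    (z : List Bool) (hz : ReadsFrom Z 0 z) (hzl : z.length ≤ l) (hp : p ≤ l) :
    ∃ (t : ℕ) (s : (thresholdTM H e).Cfg), t ≤ (P + 1) * (2 * l + 6) ∧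
      (thresholdTM H e).Reach (zconf H e R h (.inl (.rewind false))
        (norm (fun _ => none) (P + 1)) P b Z p) t s ∧ s.Halted ∧
      (s.Reads [true] ↔ 2 * (binVal z + 1) ≤ P) := by
  induction P using Nat.strong_induction_on generalizing Z p z with
  | _ P ih =>
  have hrew := reach_rewind (H := H) (R := R) (h := h) hl false (norm (fun _ => none) (P + 1)) P b Z p
  have hreject : ∀ P T, ¬ (zconf H e R h (.inl .halt) (norm T (P + 1)) 0 b Z 0).Reads [true] := by
    intro P T hr
    have h1 : some false = some true := hr 0 (by simp)
    simp at h1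
  have hcount : ∀ P, 1 ≤ P → ∀ c, (thresholdTM H e).step c
      (zconf H e R h (.inl .count) (norm (fun _ => none) (P + 1)) P b Z 0) =
      (zconf H e R h (.inl .count') (norm (fun _ => none) P) (P - 1) b Z 0) := by
    intro P hP c
    rw [step_zconf (s' := .inl .count') (w₀ := none) (w := Z 0)
      (m₀ := .left) (m := .stay) (mB := .stay) hl (by simp) (by simp)
      (fun rs hrs => by simp [act, norm_lt, hP, hrs]), norm_update_none hP]
    simp [Move.apply]
  match P, ih, hrew with
  | 0, _, hrew =>
    refine ⟨p + 1 + 1, _, by omega, hrew.trans (TM.Reach.single fun c => ?_),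
      halted_zconf (R := R) (h := h) hl (norm (fun _ => none) 1) 0 b Z 0, ?_⟩
    · rw [step_zconf (s' := .inl .halt) (w₀ := bit false) (w := Z 0)
        (m₀ := .stay) (m := .stay) (mB := .stay) hl (by simp) (by simp)
        (fun rs hrs => by simp [act, norm_zero, hrs])]
      simp [Move.apply, norm_update_zero]
    · exact iff_of_false (hreject 0 _) (by omega)
  | 1, _, hrew =>
    refine ⟨p + 1 + 1 + 1, _, by omega,
      (hrew.trans (TM.Reach.single (hcount 1 le_rfl))).trans (TM.Reach.single fun c => ?_),
      halted_zconf (R := R) (h := h) hl (norm (fun _ => none) 1) 0 b Z 0, ?_⟩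
    · rw [step_zconf (s' := .inl .halt) (w₀ := bit false) (w := Z 0)
        (m₀ := .stay) (m := .stay) (mB := .stay) hl (by simp) (by simp)
        (fun rs hrs => by simp [act, norm_zero, hrs])]
      simp [Move.apply, norm_update_zero]
    · exact iff_of_false (hreject 0 _) (by omega)
  | P + 2, ih, hrew =>
    have hstart : (thresholdTM H e).Reach (zconf H e R h (.inl (.rewind false))
        (norm (fun _ => none) (P + 2 + 1)) (P + 2) b Z p) (p + 1 + 1 + 1)
        (zconf H e R h (.inl .pred) (norm (fun _ => none) (P + 1)) P b Z 0) := by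
      refine (hrew.trans (TM.Reach.single (hcount (P + 2) (by omega)))).trans
        (TM.Reach.single fun c => ?_)
      rw [step_zconf (s' := .inl .pred) (w₀ := none) (w := Z 0)
        (m₀ := .left) (m := .stay) (mB := .stay) hl (by simp) (by simp)
        (fun rs hrs => by simp [act, norm_lt, hrs])]
      simp only [show P + 2 - 1 = P + 1 from rfl]
      rw [norm_update_none (by omega)]
      simp [Move.apply]
    have hmul : (P + 2 + 1) * (2 * l + 6) = (P + 1) * (2 * l + 6) + 2 * (2 * l + 6) := by ring
    rcases reach_pred (H := H) (R := R) (h := h) hl (norm (fun _ => none) (P + 1)) P b z Z 0 hz with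
      ⟨hv, t, Z', p', ht, hr⟩ | ⟨t, Z', p', z', ht, hp', hlen, hv, hzz, -, hr⟩
    · refine ⟨_, _, ?_, (hstart.trans hr).trans (reach_accept hl P b Z' p'),
        halted_zconf hl _ _ _ _ _, iff_of_true ?_ (by omega)⟩
      · have : (P + 1) * 1 ≤ (P + 1) * (2 * l + 6) := Nat.mul_le_mul_left _ (by omega)
        omega
      · intro i hi
        simp only [List.length_singleton] at hi
        change TM.bitOf (Function.update (norm (fun _ => none) 1) 0 (bit true) i) = _
        interval_cases i <;> simp [norm, TM.bitOf]
    · obtain ⟨t', s, ht', hs, hh, hiff⟩ := ih P (by omega) Z' p' z' hzz (by omega) (by omega)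
      refine ⟨_, s, ?_, (hstart.trans hr).trans hs, hh, hiff.trans (by omega)⟩
      omega


variable (H e) in
/-- The configurations before the simulation: the simulated tapes but the first are empty. -/
abbrev preconf (s : Ctl H.q) (T : ℕ → Sym H.g) (P b : ℕ) (Z : ℕ → Sym H.g) (p : ℕ) :
    (thresholdTM H e).Cfg :=
  zconf H e (fun _ _ => none) (fun _ => 0) s T P b Z p

theorem pairInput_getElem?_lt {n i : ℕ} (y : List Bool) (hi : i < n) :
    (pairInput n y)[i]? = some true := by
  simp [pairInput, List.getElem?_append_left, hi]

theorem pairInput_getElem?_self (n : ℕ) (y : List Bool) : (pairInput n y)[n]? = some false := by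
  simp [pairInput]

theorem pairInput_getElem?_add (n : ℕ) (y : List Bool) (i : ℕ) :
    (pairInput n y)[n + 1 + i]? = y[i]? := by
  rw [pairInput, List.getElem?_append_right (by simp; omega)]
  simp [show n + 1 + i - n = i + 1 by omega]

theorem onFirst_const {g : ℕ} (w : Sym g) :
    onFirst (fun _ : Fin (k + 1) => w) w .stay = fun _ => (w, .stay) := by
  funext i
  simp [onFirst]

theorem step_init (h0 : e (.inl .start) = 0) (hl : e (.inl .halt) = Fin.last q) (x : List Bool)
    (c : Bool) {o : Act H.q H.g k}
    (ho : act H (.inl .start) c (listTape x 0) none none (fun _ => none) = o) :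
    (thresholdTM H e).step c ((thresholdTM H e).init x) =
      { state := e o.next
        tape := Matrix.vecCons (Function.update (listTape x) 0 o.input.1)
          (Matrix.vecCons mark (Matrix.vecCons mark
            (fun i => Function.update (fun _ => none) 0 (o.sim i).1)))
        head := Matrix.vecCons (o.input.2.apply 0) (Matrix.vecCons (o.moveA.apply 0)
          (Matrix.vecCons (o.moveB.apply 0) (fun i => (o.sim i).2.apply 0))) } := by
  have h1 : ((thresholdTM H e).init x).state ≠ Fin.last (thresholdTM H e).q := by
    change (0 : Fin (q + 1)) ≠ Fin.last q
    rw [← hl, ← h0]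
    exact e.injective.ne (by simp)
  have hm : Function.update (fun _ => none) 0 (bit true) = (mark : ℕ → Sym H.g) := by
    funext i
    by_cases hi : i = 0 <;> simp [mark, hi]
  have hT : ((thresholdTM H e).init x).tape =
      Matrix.vecCons (listTape x) (Matrix.vecCons (fun _ => none) (Matrix.vecCons (fun _ => none)
        (fun _ _ => none))) := by
    funext i j
    refine Fin.cases ?_ (fun i => Fin.cases ?_ (fun i => Fin.cases ?_ (fun i => ?_) i) i) i <;>
    rfl
  have hh : ((thresholdTM H e).init x).head = fun _ => 0 := rfl
  have hs : e.symm ((thresholdTM H e).init x).state = .inl .start :=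
    (Equiv.symm_apply_eq e).2 h0.symm
  rw [TM.step, if_neg h1, hT, hh]
  subst ho
  generalize ((thresholdTM H e).init x).state = s at hs
  simp only [thresholdTM, Matrix.cons_val_zero, Matrix.cons_val_succ, hs, if_true]
  simp only [TM.Cfg.mk.injEq]
  refine ⟨trivial, ?_, ?_⟩ <;>
  · funext i
    refine Fin.cases ?_ (fun i => Fin.cases ?_ (fun i => Fin.cases ?_ (fun i => ?_) i) i) i <;>
    simp [hm]

theorem step_init_pos (h0 : e (.inl .start) = 0) (hl : e (.inl .halt) = Fin.last q) {n : ℕ}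
    (hn : 1 ≤ n) (y : List Bool) (c : Bool) :
    (thresholdTM H e).step c ((thresholdTM H e).init (pairInput n y)) =
      preconf H e (.inl .ones) (norm (listTape (pairInput n y)) 1) 1 1 (fun _ => none) 0 := by
  have hI : (listTape (pairInput n y) : ℕ → Sym H.g) 0 = bit true := by
    rw [listTape, pairInput_getElem?_lt y hn]
    rfl
  have hT : Function.update (listTape (pairInput n y)) 0 (bit false)
      = norm (listTape (pairInput n y) : ℕ → Sym H.g) 1 := by
    funext i
    by_cases hi : i = 0 <;> simp [norm, hi]
  rw [step_init h0 hl _ c (o := ⟨.inl .ones, (bit false, .right), .stay, .right,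
    fun _ => (none, .stay)⟩) (by simp [act, hI, onFirst_const]), ← hT, preconf, zconf, conf]
  simp only [Move.apply, Function.update_eq_self]
  congr 4
  funext i
  exact Function.update_eq_self 0 (fun _ : ℕ => (none : Sym H.g))

theorem step_init_zero (h0 : e (.inl .start) = 0) (hl : e (.inl .halt) = Fin.last q)
    (y : List Bool) (c : Bool) :
    ((thresholdTM H e).step c ((thresholdTM H e).init (pairInput 0 y))).Halted := by
  rw [step_init h0 hl _ c (o := ⟨.inl .halt, (bit false, .stay), .stay, .stay,
    fun _ => (none, .stay)⟩) (by simp [act, listTape, pairInput, onFirst_const])]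
  exact hl

/-- The first `1` moves the second marked head by one cell and every later one by two, so after all
`n` of them it stands in cell 2n - 1. This is the allowance for the length of the string to be
copied. -/
theorem reach_ones (hl : e (.inl .halt) = Fin.last q) {n : ℕ} (y : List Bool) {i : ℕ}
    (hi : 1 + i ≤ n) (Z : ℕ → Sym H.g) (p : ℕ) :
    (thresholdTM H e).Reach
      (preconf H e (.inl .ones) (norm (listTape (pairInput n y)) 1) 1 1 Z p) (2 * i)
      (preconf H e (.inl .ones) (norm (listTape (pairInput n y)) (1 + i)) (1 + i) (1 + 2 * i)
        Z p) := by
  induction i with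
  | zero => exact TM.Reach.refl _
  | succ i ih =>
    rw [Nat.mul_succ]
    refine (ih (by omega)).trans (TM.Reach.head (s' := preconf H e (.inl .ones')
      (norm (listTape (pairInput n y)) (1 + i)) (1 + i) (1 + 2 * i + 1) Z p)
      (fun c => ?_) (TM.Reach.single fun c => ?_))
    · have hr : norm (listTape (pairInput n y) : ℕ → Sym H.g) (1 + i) (1 + i) = bit true := by
        rw [norm_self _ (by omega), listTape, pairInput_getElem?_lt y (by omega)]
        rfl
      rw [step_zconf (s' := .inl .ones') (w₀ := norm (listTape (pairInput n y)) (1 + i) (1 + i))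
        (w := Z p) (m₀ := .stay) (m := .stay) (mB := .right) hl (by simp) (by simp)
        (fun rs hrs => by simp [act, hr, hrs])]
      simp [Move.apply]
    · rw [step_zconf (s' := .inl .ones) (w₀ := bit true)
        (w := Z p) (m₀ := .right) (m := .stay) (mB := .right) hl (by simp) (by simp)
        (fun rs hrs => by simp [act, hrs]), norm_update_true _ (by omega)]
      simp [Move.apply]
      congr 1

theorem step_separator (hl : e (.inl .halt) = Fin.last q) {n : ℕ} (hn : 1 ≤ n) (y : List Bool)
    (b : ℕ) (Z : ℕ → Sym H.g) (p : ℕ) (c : Bool) :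
    (thresholdTM H e).step c
      (preconf H e (.inl .ones) (norm (listTape (pairInput n y)) n) n b Z p) =
      preconf H e (.inl .copy) (norm (listTape (pairInput n y)) (n + 1)) (n + 1) b Z p := by
  have hr : norm (listTape (pairInput n y) : ℕ → Sym H.g) n n = bit false := by
    rw [norm_self _ hn, listTape, pairInput_getElem?_self]
    rfl
  rw [step_zconf (s' := .inl .copy) (w₀ := bit true)
    (w := Z p) (m₀ := .right) (m := .stay) (mB := .stay) hl (by simp) (by simp)
    (fun rs hrs => by simp [act, hr, hrs]), norm_update_true _ hn]
  simp [Move.apply]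

theorem reach_copy (hl : e (.inl .halt) = Fin.last q) (n : ℕ) (y : List Bool) {i B : ℕ}
    (hi : i ≤ y.length) (hB : i ≤ B) :
    (thresholdTM H e).Reach
      (preconf H e (.inl .copy) (norm (listTape (pairInput n y)) (n + 1)) (n + 1) B
        (fun _ => none) 0) i
      (preconf H e (.inl .copy) (norm (listTape (pairInput n y)) (n + 1 + i)) (n + 1 + i) (B - i)
        (listTape (y.take i)) i) := by
  induction i with
  | zero =>
    rw [List.take_zero]
    exact TM.Reach.refl _
  | succ i ih =>
    refine (ih (by omega) (by omega)).trans (TM.Reach.single fun c => ?_)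
    have hr : norm (listTape (pairInput n y) : ℕ → Sym H.g) (n + 1 + i) (n + 1 + i)
        = bit y[i] := by
      rw [norm_self _ (by omega), listTape, pairInput_getElem?_add]
      simp [show i < y.length by omega]
    obtain ⟨b, hb⟩ : ∃ b, B - i = b + 1 := ⟨B - i - 1, by omega⟩
    have hlen : (y.take i).length = i := by simp; omega
    have hZ : Function.update (listTape (y.take i) : ℕ → Sym H.g) i (bit y[i])
        = listTape (y.take (i + 1)) := by
      rw [List.take_succ_eq_append_getElem (by omega), ← listTape_update, hlen]
    rw [hb, step_zconf (s' := .inl .copy) (w₀ := bit true)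
      (w := bit y[i]) (m₀ := .right) (m := .right) (mB := .left) hl (by simp) (by simp)
      (fun rs hrs => by simp [act, hr, mark_succ]), norm_update_true _ (by omega), hZ]
    simp only [Move.apply]
    congr 1
    omega

/-- The allowance is used up and the string continues: the machine gives up. This keeps its running
time polynomial in `n`, however long the second component is. -/
theorem step_copy_overflow (hl : e (.inl .halt) = Fin.last q) (n : ℕ) (y : List Bool) {i : ℕ}
    (hi : i < y.length) (Z : ℕ → Sym H.g) (p : ℕ) (c : Bool) :
    ((thresholdTM H e).step c
      (preconf H e (.inl .copy) (norm (listTape (pairInput n y)) (n + 1 + i)) (n + 1 + i) 0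
        Z p)).Halted := by
  have hr : norm (listTape (pairInput n y) : ℕ → Sym H.g) (n + 1 + i) (n + 1 + i)
      = bit y[i] := by
    rw [norm_self _ (by omega), listTape, pairInput_getElem?_add]
    simp [hi]
  rw [step_zconf (s' := .inl .halt) (w₀ := bit y[i])
    (w := Z p) (m₀ := .stay) (m := .stay) (mB := .stay) hl (by simp) (by simp)
    (fun rs hrs => by simp [act, hr, mark_zero, hrs])]
  exact hl

theorem step_copy_end (hl : e (.inl .halt) = Fin.last q) (n : ℕ) (y : List Bool) (b : ℕ)
    (Z : ℕ → Sym H.g) (p : ℕ) (c : Bool) :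
    (thresholdTM H e).step c
      (preconf H e (.inl .copy) (norm (listTape (pairInput n y)) (n + 1 + y.length))
        (n + 1 + y.length) b Z p) =
      preconf H e (.inl (.rewind true)) (norm (fun _ => none) (n + 1 + y.length + 1))
        (n + 1 + y.length) b Z p := by
  have hI : ∀ i, (listTape (pairInput n y) : ℕ → Sym H.g) (n + 1 + y.length + i) = none := by
    intro i
    rw [listTape, add_assoc, pairInput_getElem?_add, List.getElem?_eq_none (by omega)]
    rfl
  have hr : norm (listTape (pairInput n y) : ℕ → Sym H.g) (n + 1 + y.length) (n + 1 + y.length)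
      = none := by
    rw [norm_self _ (by omega)]
    exact hI 0
  have hT : norm (listTape (pairInput n y) : ℕ → Sym H.g) (n + 1 + y.length + 1)
      = norm (fun _ => none) (n + 1 + y.length + 1) := by
    funext i
    simp only [norm]
    split_ifs with h1 h2
    · rfl
    · rfl
    · obtain ⟨j, rfl⟩ := Nat.exists_eq_add_of_le (show n + 1 + y.length ≤ i by omega)
      exact hI j
  rw [step_zconf (s' := .inl (.rewind true)) (w₀ := bit true)
    (w := Z p) (m₀ := .stay) (m := .stay) (mB := .stay) hl (by simp) (by simp)
    (fun rs hrs => by simp [act, hr, hrs]), norm_update_true _ (by omega), hT]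
  simp [Move.apply]

variable (H e) in
/-- The configuration during the simulation of `H`. -/
def simconf (T : ℕ → Sym H.g) (P b : ℕ) (s : H.Cfg) : (thresholdTM H e).Cfg :=
  conf H e (.inr s.state) T P (s.head 0) b s.tape s.head

theorem runFrom_simconf (hl : e (.inl .halt) = Fin.last q) (T : ℕ → Sym H.g) (P b : ℕ)
    (ρ : ℕ → Bool) (s : H.Cfg) {t : ℕ} (ht : ∀ j < t, ¬ (H.runFrom ρ s j).Halted) :
    (thresholdTM H e).runFrom ρ (simconf H e T P b s) t
      = simconf H e T P b (H.runFrom ρ s t) := by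
  induction t with
  | zero => rfl
  | succ t ih =>
    rw [TM.runFrom, ih fun j hj => ht j (by omega), TM.runFrom]
    have hs := ht t (by omega)
    generalize H.runFrom ρ s t = s' at hs
    have hs' : s'.state ≠ Fin.last H.q := hs
    rw [simconf, step_conf hl (by simp) (by simp) (o := ⟨.inr (H.δ s'.state (ρ t)
      (fun i => s'.tape i (s'.head i))).1, (T P, .stay), ((H.δ s'.state (ρ t)
      (fun i => s'.tape i (s'.head i))).2 0).2, .stay, (H.δ s'.state (ρ t)
      (fun i => s'.tape i (s'.head i))).2⟩) (ho := by simp [act, hs'])]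
    rw [TM.step, if_neg hs', simconf]
    simp [Move.apply]

theorem preconf_eq_simconf (T : ℕ → Sym H.g) (P b : ℕ) (y : List Bool) :
    preconf H e (.inr 0) T P b (listTape y) 0 = simconf H e T P b (H.init y) := by
  rw [preconf, zconf, simconf]
  congr 1
  · funext i j
    by_cases hi : i = 0
    · subst hi; simp [TM.init, listTape]
    · simp [TM.init, hi]
  · funext i
    by_cases hi : i = 0
    · subst hi; simp [TM.init]
    · simp [TM.init, hi]

theorem step_simconf_of_halted (hl : e (.inl .halt) = Fin.last q) (T : ℕ → Sym H.g) (P b : ℕ)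
    {s : H.Cfg} (hs : s.Halted) (c : Bool) :
    (thresholdTM H e).step c (simconf H e T P b s)
      = zconf H e s.tape s.head (.inl (.rewind false)) T P b (s.tape 0) (s.head 0) := by
  have h1 : simconf H e T P b s = zconf H e s.tape s.head (.inr s.state) T P b (s.tape 0)
      (s.head 0) := by
    rw [simconf, zconf, Function.update_eq_self, Function.update_eq_self]
  have hs' : s.state = Fin.last H.q := hs
  rw [h1, step_zconf (s' := .inl (.rewind false)) (w₀ := T P)
    (w := s.tape 0 (s.head 0)) (m₀ := .stay) (m := .stay) (mB := .stay) hl (by simp) (by simp)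
    (fun rs hrs => by simp [act, hs', hrs])]
  simp [Move.apply]

theorem reach_simulation (h0 : e (.inl .start) = 0) (hl : e (.inl .halt) = Fin.last q) {n : ℕ}
    (hn : 1 ≤ n) {y : List Bool} (hy : y.length + 1 ≤ 2 * n) : ∃ b,
    (thresholdTM H e).Reach ((thresholdTM H e).init (pairInput n y)) (2 * n + 2 * y.length + 2)
      (simconf H e (norm (fun _ => none) (n + 1 + y.length + 1)) (n + 1 + y.length) b
        (H.init y)) := by
  obtain ⟨n, rfl⟩ := Nat.exists_eq_add_of_le hn
  have h1 := (((reach_ones (H := H) hl y le_rfl (fun _ => none) 0).trans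
    (TM.Reach.single (step_separator hl hn y (1 + 2 * n) (fun _ => none) 0))).trans
    (reach_copy hl (1 + n) y (i := y.length) le_rfl (by omega))).trans
    (TM.Reach.head (step_copy_end hl (1 + n) y _ _ _) (reach_rewind hl true _ _ _ _ _))
  have h2 := TM.Reach.head (step_init_pos (H := H) h0 hl hn y) h1
  refine ⟨1 + 2 * n - y.length, ?_⟩
  rw [List.take_length, if_pos rfl, ← preconf, preconf_eq_simconf] at h2
  convert h2 using 1
  ring

theorem halted_of_overflow (h0 : e (.inl .start) = 0) (hl : e (.inl .halt) = Fin.last q) {n : ℕ}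
    (hn : 1 ≤ n) {y : List Bool} (hy : 2 * n ≤ y.length) (ρ : ℕ → Bool) :
    ((thresholdTM H e).run ρ (pairInput n y) (4 * n)).Halted := by
  obtain ⟨n, rfl⟩ := Nat.exists_eq_add_of_le hn
  have h1 := ((reach_ones (H := H) hl y le_rfl (fun _ => none) 0).trans
    (TM.Reach.single (step_separator hl hn y (1 + 2 * n) (fun _ => none) 0))).trans
    (reach_copy hl (1 + n) y (i := 1 + 2 * n) (by omega) (by omega))
  have h2 := TM.Reach.head (step_init_pos (H := H) h0 hl hn y) h1
  rw [show 4 * (1 + n) = 2 * n + 1 + (1 + 2 * n) + 1 + 1 by ring, TM.run_eq_runFrom, TM.runFrom,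
    h2, Nat.sub_self]
  exact step_copy_overflow hl _ _ (by omega) _ _ _

/-- The simulated machine sees the coins only from the time at which the simulation starts, hence
the shift of `ρ`. -/
theorem run_thresholdTM (h0 : e (.inl .start) = 0) (hl : e (.inl .halt) = Fin.last q) {n : ℕ}
    (hn : 1 ≤ n) {y : List Bool} (hy : y.length + 1 ≤ 2 * n) (ρ : ℕ → Bool) {t u : ℕ}
    (ht : (H.run (fun i => ρ (2 * n + 2 * y.length + 2 + i)) y t).Halted)
    (hu : 2 * n + 2 * y.length + 2 + t + 1 +
      (n + 1 + y.length + 1) * (2 * (y.length + t) + 6) ≤ u) :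
    ((thresholdTM H e).run ρ (pairInput n y) u).Halted ∧
    ((thresholdTM H e).Outputs ρ (pairInput n y) u [true] ↔
      ∃ z, H.Outputs (fun i => ρ (2 * n + 2 * y.length + 2 + i)) y t z ∧
        2 * (binVal z + 1) ≤ n + 1 + y.length) := by
  obtain ⟨b, hb⟩ := reach_simulation (H := H) h0 hl hn hy
  set t₀ := 2 * n + 2 * y.length + 2
  set σ : ℕ → Bool := fun i => ρ (t₀ + i) with hσ
  classical
  -- The comparison begins as soon as `H` halts, which may be before `t`. The first halting time `τ`
  -- is needed, and the output no longer changes between `τ` and `t`.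
  have hex : ∃ j, (H.run σ y j).Halted := ⟨t, ht⟩
  have hτt : Nat.find hex ≤ t := Nat.find_min' hex ht
  have hmin : ∀ j < Nat.find hex, ¬ (H.runFrom σ (H.init y) j).Halted := fun j hj => by
    rw [← TM.run_eq_runFrom]
    exact Nat.find_min hex hj
  have hhalt := Nat.find_spec hex
  generalize Nat.find hex = τ at hτt hmin hhalt
  have hrun := TM.run_eq_of_halted hhalt hτt
  obtain ⟨z, hzl, hz⟩ := H.exists_reads σ y τ
  have hzr : ReadsFrom ((H.run σ y τ).tape 0) 0 z := fun i hi => by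
    rw [Nat.zero_add]
    exact hz i hi
  obtain ⟨v, s, hv, hs, hsh, hiff⟩ := reach_count (H := H) hl b (y.length + t)
    (n + 1 + y.length) ((H.run σ y τ).tape 0) ((H.run σ y τ).head 0) z hzr (by omega)
    (by have := TM.head_run_le H σ y τ 0; omega)
    (R := (H.run σ y τ).tape) (h := (H.run σ y τ).head)
  have hD : (thresholdTM H e).run ρ (pairInput n y) (t₀ + (τ + (v + 1))) = s := by
    rw [TM.run_eq_runFrom, TM.runFrom_add, hb, TM.runFrom_add, runFrom_simconf hl _ _ _ _ _ hmin,
      ← TM.run_eq_runFrom]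
    exact TM.Reach.head (step_simconf_of_halted hl _ _ _ hhalt) hs _
  have hDu : (thresholdTM H e).run ρ (pairInput n y) u = s := by
    rw [TM.run_eq_of_halted (hD ▸ hsh) (by omega), hD]
  refine ⟨hDu ▸ hsh, ?_⟩
  rw [TM.Outputs, hDu, and_iff_right hsh, hiff]
  constructor
  · exact fun h => ⟨z, ⟨ht, hrun ▸ hz⟩, h⟩
  · rintro ⟨z', hz', h⟩
    rwa [hz'.2.unique (hrun ▸ hz : (H.run σ y t).Reads z)] at h

end Machine

theorem eval_mono (T : Polynomial ℕ) {a b : ℕ} (h : a ≤ b) : T.eval a ≤ T.eval b := by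
  rw [Polynomial.eval_eq_sum, Polynomial.eval_eq_sum]
  exact Finset.sum_le_sum fun i _ => Nat.mul_le_mul_left _ (Nat.pow_le_pow_left h i)

/-- There is a machine that accepts `(1^n, y)` if and only if `H(y)` is less than about
`(n + |y|) / 2`. -/
theorem exists_threshold_machine {k : ℕ} (H : TM Bool k) (T : Polynomial ℕ)
    (hT : RunsInTime H T) : ∃ (D : TM Bool (k + 3)) (TD : Polynomial ℕ), RunsInTimeFirst D TD ∧
    ∀ (n : ℕ) (y : List Bool), 1 ≤ n → y.length + 1 ≤ 2 * n →
      ∃ t₀, t₀ + T.eval y.length ≤ TD.eval n ∧ ∀ ρ,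
        (D.Outputs ρ (pairInput n y) (TD.eval n) [true] ↔
          ∃ z, H.Outputs (fun i => ρ (t₀ + i)) y (T.eval y.length) z ∧
            2 * (binVal z + 1) ≤ n + 1 + y.length) := by
  obtain ⟨q, e, h0, hl⟩ := exists_equiv_fin (Q := Ctl H.q)
    (show (.inl .start : Ctl H.q) ≠ .inl .halt by simp)
  -- Strings that pass the copying phase are shorter than 2n.
  let T₂ : Polynomial ℕ := T.comp (2 * Polynomial.X)
  let TD : Polynomial ℕ := 6 * Polynomial.X + 4 + T₂ +
    (3 * Polynomial.X + 2) * (2 * (2 * Polynomial.X + T₂) + 6)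
  have hTD : ∀ n, TD.eval n = 6 * n + 4 + T.eval (2 * n) +
      (3 * n + 2) * (2 * (2 * n + T.eval (2 * n)) + 6) := by
    intro n
    simp [TD, T₂]
  have hle : ∀ (n : ℕ) (y : List Bool), y.length + 1 ≤ 2 * n →
      2 * n + 2 * y.length + 2 + T.eval y.length + 1 +
      (n + 1 + y.length + 1) * (2 * (y.length + T.eval y.length) + 6) ≤ TD.eval n := by
    intro n y hy
    rw [hTD]
    have h1 : T.eval y.length ≤ T.eval (2 * n) := eval_mono T (by omega)
    have h2 : (n + 1 + y.length + 1) * (2 * (y.length + T.eval y.length) + 6) ≤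
        (3 * n + 2) * (2 * (2 * n + T.eval (2 * n)) + 6) := Nat.mul_le_mul (by omega) (by omega)
    omega
  refine ⟨thresholdTM H e, TD, fun n y ρ => ?_, fun n y hn hy => ?_⟩
  · rcases Nat.eq_zero_or_pos n with rfl | hn
    · have h1 : ((thresholdTM H e).run ρ (pairInput 0 y) 1).Halted :=
        step_init_zero h0 hl y (ρ 0)
      rw [TM.run_eq_of_halted h1 (by rw [hTD]; omega)]
      exact h1
    · by_cases hy : y.length + 1 ≤ 2 * n
      · exact (run_thresholdTM h0 hl hn hy ρ (hT y _) (hle n y hy)).1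
      · have h1 := halted_of_overflow (H := H) h0 hl hn (y := y) (by omega) ρ
        rw [TM.run_eq_of_halted h1 (by rw [hTD]; omega)]
        exact h1
  · exact ⟨2 * n + 2 * y.length + 2, le_trans (by omega) (hle n y hy),
      fun ρ => (run_thresholdTM h0 hl hn hy ρ (hT y _) (hle n y hy)).2⟩


/-! ### Probabilities over coin tosses -/

theorem coinProb_nonneg (T : ℕ) (P : (ℕ → Bool) → Prop) : 0 ≤ coinProb T P := by
  unfold coinProb; positivity

theorem coinProb_mono (T : ℕ) {P Q : (ℕ → Bool) → Prop} (h : ∀ ρ, P ρ → Q ρ) :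
    coinProb T P ≤ coinProb T Q := by
  unfold coinProb
  gcongr
  exact Nat.card_le_card_of_injective (fun r => ⟨r.1, h _ r.2⟩)
    (fun r s hrs => Subtype.ext (Subtype.mk.inj hrs))

theorem coinProb_add_le_one (T : ℕ) {P Q : (ℕ → Bool) → Prop} (h : ∀ ρ, P ρ → ¬ Q ρ) :
    coinProb T P + coinProb T Q ≤ 1 := by
  unfold coinProb
  rw [← add_div, div_le_one (by positivity), ← Nat.cast_add, ← Nat.card_sum]
  have h2 : Nat.card (Fin T → Bool) = 2 ^ T := by simp
  rw [show (2 : ℝ) ^ T = ((2 ^ T : ℕ) : ℝ) by simp, ← h2, Nat.cast_le]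
  refine Nat.card_le_card_of_injective (Sum.elim Subtype.val Subtype.val) ?_
  rintro (r | r) (s | s) hrs
  · exact congrArg Sum.inl (Subtype.ext hrs)
  · exact absurd ((show r.1 = s.1 from hrs) ▸ s.2) (h _ r.2)
  · exact absurd ((show r.1 = s.1 from hrs) ▸ r.2) (h _ s.2)
  · exact congrArg Sum.inr (Subtype.ext hrs)

theorem coinProb_le_one (T : ℕ) (P : (ℕ → Bool) → Prop) : coinProb T P ≤ 1 := by
  have h1 := coinProb_add_le_one T (P := P) (Q := fun ρ => ¬ P ρ) (fun _ h h' => h' h)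
  linarith [coinProb_nonneg T (fun ρ => ¬ P ρ)]

/-- All fibres of the restriction of coin sequences along `e` have the same size `N`, the number of
choices for the coins outside the range of `e`. -/
theorem card_comp_injective {S T : Type} [Fintype S] [Fintype T] {e : S → T}
    (he : Function.Injective e) : ∃ N : ℕ, ∀ Q : (S → Bool) → Prop,
      Nat.card {r : T → Bool // Q (r ∘ e)} = Nat.card {r : S → Bool // Q r} * N := by
  classical
  let p : T → Prop := fun i => i ∈ Set.range e
  refine ⟨Nat.card ({x // ¬ p x} → Bool), fun Q => ?_⟩
  rw [← Nat.card_prod]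
  let f : (T → Bool) ≃ (S → Bool) × ({x // ¬ p x} → Bool) :=
    (Equiv.piEquivPiSubtypeProd p (fun _ => Bool)).trans
      (Equiv.prodCongr (Equiv.arrowCongr (Equiv.ofInjective e he).symm (Equiv.refl _))
        (Equiv.refl _))
  have hf : ∀ r, (f r).1 = r ∘ e := fun r => rfl
  refine Nat.card_congr ((f.subtypeEquiv (q := fun u => Q u.1) fun r => ?_).trans ?_)
  · rw [hf]
  · exact Equiv.prodSubtypeFstEquivSubtypeProd

/-- Coins tossed before and after the window [a, a + S) do not matter, so the distinguisher's
simulation of `H` has the same probabilities as `H` itself. -/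
theorem coinProb_shift {a S T : ℕ} (h : a + S ≤ T) {P : (ℕ → Bool) → Prop}
    (hP : ∀ ρ σ : ℕ → Bool, (∀ i < S, ρ i = σ i) → (P ρ ↔ P σ)) :
    coinProb T (fun ρ => P (fun i => ρ (a + i))) = coinProb S P := by
  let e : Fin S → Fin T := fun i => ⟨a + i, by omega⟩
  have he : Function.Injective e := fun i j hij => by
    have := congrArg Fin.val hij
    simp only [e] at this
    omega
  obtain ⟨N, hN⟩ := card_comp_injective he
  have h1 := hN (fun _ => True)
  have h2 := hN (fun r => P (fun i => if h : i < S then r ⟨i, h⟩ else false))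
  have h3 : Nat.card {r : Fin T → Bool // P (fun i => if h : a + i < T then r ⟨a + i, h⟩ else false)}
      = Nat.card {r : Fin T → Bool // P (fun i => if h : i < S then (r ∘ e) ⟨i, h⟩ else false)} := by
    refine Nat.card_congr (Equiv.subtypeEquivRight fun r => hP _ _ fun i hi => ?_)
    simp [hi, show a + i < T by omega, e]
  have h4 : 2 ^ T = 2 ^ S * N := by simpa using h1
  have hN0 : (N : ℝ) ≠ 0 := by
    rintro h0
    rw [Nat.cast_eq_zero] at h0
    simp [h0] at h4
  unfold coinProb
  rw [h3, h2, show (2 : ℝ) ^ T = 2 ^ S * N by exact_mod_cast h4, Nat.cast_mul]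
  exact mul_div_mul_right _ _ hN0

/-! ### Entropy -/

section Entropy

variable {V : Type} [Fintype V]

theorem sum_toReal (X : PMF V) : ∑ v, (X v).toReal = 1 := by
  rw [← ENNReal.toReal_sum fun v _ => X.apply_ne_top v, ← tsum_fintype (L := .unconditional V),
    X.tsum_coe]
  rfl

/-- Gibbs' inequality, from log u ≤ u - 1 applied termwise. -/
theorem entropy_le_cross (X : PMF V) {r : V → ℝ} (hr : ∀ v, 0 ≤ r v)
    (hpos : ∀ v, X v ≠ 0 → 0 < r v) (hsum : ∑ v, r v ≤ 1) :
    entropy X ≤ ∑ v, (X v).toReal * Real.logb 2 (1 / r v) := by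
  have h2 : 0 < Real.log 2 := Real.log_pos (by norm_num)
  have key : ∀ v, (X v).toReal * Real.logb 2 (1 / (X v).toReal) ≤
      (X v).toReal * Real.logb 2 (1 / r v) + (r v - (X v).toReal) / Real.log 2 := by
    intro v
    by_cases hv : X v = 0
    · simp only [hv, ENNReal.toReal_zero, zero_mul, sub_zero, zero_add]
      exact div_nonneg (hr v) h2.le
    · have hx : 0 < (X v).toReal := ENNReal.toReal_pos hv (X.apply_ne_top v)
      have hq := hpos v hv
      have h3 : Real.log (r v / (X v).toReal) ≤ r v / (X v).toReal - 1 :=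
        Real.log_le_sub_one_of_pos (by positivity)
      rw [Real.log_div hq.ne' hx.ne'] at h3
      have h4 : (X v).toReal * (Real.log (r v) - Real.log (X v).toReal) ≤ r v - (X v).toReal := by
        calc _ ≤ (X v).toReal * (r v / (X v).toReal - 1) := by gcongr
          _ = _ := by field_simp
      simp only [one_div, Real.logb, Real.log_inv, neg_div]
      rw [← sub_nonneg]
      have : (X v).toReal * -(Real.log (r v) / Real.log 2) + (r v - (X v).toReal) / Real.log 2 -
          (X v).toReal * -(Real.log (X v).toReal / Real.log 2) =
          ((r v - (X v).toReal) - (X v).toReal * (Real.log (r v) - Real.log (X v).toReal))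
            / Real.log 2 := by
        field_simp
        ring
      rw [this]
      exact div_nonneg (by linarith) h2.le
  calc entropy X ≤ ∑ v, ((X v).toReal * Real.logb 2 (1 / r v) +
        (r v - (X v).toReal) / Real.log 2) := Finset.sum_le_sum fun v _ => key v
    _ = ∑ v, (X v).toReal * Real.logb 2 (1 / r v) + (∑ v, r v - 1) / Real.log 2 := by
      rw [Finset.sum_add_distrib, ← Finset.sum_div, Finset.sum_sub_distrib, sum_toReal]
    _ ≤ _ := by
      have : (∑ v, r v - 1) / Real.log 2 ≤ 0 := div_nonpos_of_nonpos_of_nonneg (by linarith) h2.le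
      linarith

/-- If `X` is supported on `W` and hits `S` with probability `x`, then its entropy is at most
`x log |S| + (1 - x) log |W| + 1`. -/
theorem entropy_le_of_split [DecidableEq V] (X : PMF V) (S W : Finset V)
    (hW : ∀ v, X v ≠ 0 → v ∈ W) {B A : ℝ} (hB : 0 < B) (hA : 0 < A) (hSB : (S.card : ℝ) ≤ B)
    (hWA : (W.card : ℝ) ≤ A) :
    entropy X ≤ (∑ v ∈ S, (X v).toReal) * (1 + Real.logb 2 B) +
      (1 - ∑ v ∈ S, (X v).toReal) * (1 + Real.logb 2 A) := by
  -- The reference weights in Gibbs' inequality: at most half of the mass is spread over `S` and at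
  -- most half over the rest of `W`. The halving is the extra bit in both terms of the bound.
  let r : V → ℝ := fun v => if v ∈ S then 1 / (2 * B) else if v ∈ W then 1 / (2 * A) else 0
  have hr : ∀ v, 0 ≤ r v := fun v => by simp only [r]; split_ifs <;> positivity
  have hle : ∀ v, r v ≤ (if v ∈ S then 1 / (2 * B) else 0) + (if v ∈ W then 1 / (2 * A) else 0) := by
    intro v
    simp only [r]
    split_ifs <;> simp <;> positivity
  refine (entropy_le_cross X hr (fun v hv => ?_) ?_).trans_eq ?_
  · simp only [r, hW v hv, if_true]
    split_ifs <;> positivity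
  · refine (Finset.sum_le_sum fun v _ => hle v).trans ?_
    rw [Finset.sum_add_distrib, Finset.sum_ite_mem, Finset.sum_ite_mem, Finset.univ_inter,
      Finset.univ_inter, Finset.sum_const, Finset.sum_const, nsmul_eq_mul, nsmul_eq_mul]
    have h1 : (S.card : ℝ) * (1 / (2 * B)) ≤ 1 / 2 := by
      rw [mul_one_div, div_le_iff₀ (by positivity)]; linarith
    have h2 : (W.card : ℝ) * (1 / (2 * A)) ≤ 1 / 2 := by
      rw [mul_one_div, div_le_iff₀ (by positivity)]; linarith
    linarith
  · have hlog : ∀ C : ℝ, 0 < C → Real.logb 2 (1 / (1 / (2 * C))) = 1 + Real.logb 2 C := by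
      intro C hC
      rw [one_div_one_div, Real.logb_mul (by norm_num) hC.ne', Real.logb_self_eq_one (by norm_num)]
    have hterm : ∀ v, (X v).toReal * Real.logb 2 (1 / r v) =
        (if v ∈ S then (X v).toReal else 0) * (1 + Real.logb 2 B) +
        ((X v).toReal - if v ∈ S then (X v).toReal else 0) * (1 + Real.logb 2 A) := by
      intro v
      by_cases hS : v ∈ S
      · simp only [r, hS, if_true, hlog B hB]
        ring
      · by_cases hv : X v = 0
        · simp [hv]
        · simp only [r, hS, hW v hv, if_true, if_false, hlog A hA]
          ring
    rw [Finset.sum_congr rfl fun v _ => hterm v, Finset.sum_add_distrib, ← Finset.sum_mul,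
      ← Finset.sum_mul, Finset.sum_sub_distrib, sum_toReal, Finset.sum_ite_mem, Finset.univ_inter]

end Entropy

/-! ### The advantage of the threshold machine -/

/-- The event that `H`, run for `t` steps, approximates `f x` up to `b`. -/
def Approximates {k : ℕ} (H : TM Bool k) (t : ℕ) (f : List Bool → ℕ) (b : ℝ) (x : List Bool)
    (ρ : ℕ → Bool) : Prop :=
  ∃ y, H.Outputs ρ x t y ∧ |(binVal y : ℝ) - (f x : ℝ)| ≤ b

/-- Here `a` is the acceptance probability of the distinguisher and `g` the success probability of
the approximator. On the support of `X` success forces acceptance; outside the small set `S₀` of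
simple strings it excludes it. High entropy transfers success from uniform strings to `X`. -/
theorem advantage {V : Type} [Fintype V] [DecidableEq V] (X : PMF V) (a g : V → ℝ)
    (S₀ W : Finset V) (ha1 : ∀ v, a v ≤ 1) (hg0 : ∀ v, 0 ≤ g v) (hg1 : ∀ v, g v ≤ 1)
    (hW : ∀ v, X v ≠ 0 → v ∈ W) (hag : ∀ v, X v ≠ 0 → g v ≤ a v)
    (hS₀ : ∀ v, v ∉ S₀ → a v + g v ≤ 1) {n m : ℕ} (hV : Fintype.card V = 2 ^ m)
    (hWn : W.card ≤ 2 ^ n) (hS₀c : (S₀.card : ℝ) ≤ 2 ^ m / 8) {P : ℝ} (hP : 16 ≤ P)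
    (hsum : 1 - 1 / P ≤ (∑ v, g v) / 2 ^ m) {h : ℝ} (hent : (n : ℝ) - h ≤ entropy X)
    (hlog1 : 2 * (h + 1) ≤ Real.logb 2 P - (m - n) - 1) (hlog2 : 0 < Real.logb 2 P - (m - n) - 1) :
    1 / 16 ≤ ∑ v, (X v).toReal * a v - (∑ v, a v) / 2 ^ m := by
  have hm : (0 : ℝ) < 2 ^ m := by positivity
  have hcard : ∑ _v : V, (1 : ℝ) = 2 ^ m := by
    simp [hV]
  have hbad : ∑ v, (1 - g v) ≤ 2 ^ m / P := by
    rw [Finset.sum_sub_distrib, hcard]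
    rw [le_div_iff₀ hm] at hsum
    have : (1 - 1 / P) * 2 ^ m = 2 ^ m - 2 ^ m / P := by ring
    linarith
  -- A uniform string is accepted only if the approximator fails (at most 1/P ≤ 1/16) or the string
  -- is in `S₀` (at most 1/8).
  have hunif : (∑ v, a v) / 2 ^ m ≤ 3 / 16 := by
    have h1 : ∑ v, a v ≤ ∑ v, ((1 - g v) + if v ∈ S₀ then 1 else 0) := by
      refine Finset.sum_le_sum fun v _ => ?_
      by_cases hv : v ∈ S₀
      · simp only [hv, if_true]; linarith [ha1 v, hg1 v]
      · simp only [hv, if_false]; linarith [hS₀ v hv]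
    rw [Finset.sum_add_distrib, Finset.sum_ite_mem, Finset.univ_inter, Finset.sum_const,
      nsmul_eq_mul, mul_one] at h1
    have h2 : (2 : ℝ) ^ m / P ≤ 2 ^ m / 16 := by gcongr
    rw [div_le_iff₀ hm]
    linarith
  set S : Finset V := Finset.univ.filter fun v => g v < 1 / 2 with hS
  have hSc : (S.card : ℝ) ≤ 2 * 2 ^ m / P := by
    have h1 : ∑ v ∈ S, (1 / 2 : ℝ) ≤ ∑ v, (1 - g v) :=
      (Finset.sum_le_sum fun v hv => by
        have := (Finset.mem_filter.1 hv).2; linarith).trans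
        (Finset.sum_le_univ_sum_of_nonneg fun v => by linarith [hg1 v])
    rw [Finset.sum_const, nsmul_eq_mul] at h1
    have : 2 * 2 ^ m / P = 2 * (2 ^ m / P) := by ring
    linarith
  set x := ∑ v ∈ S, (X v).toReal with hx
  have hent2 := entropy_le_of_split X S W hW (B := 2 * 2 ^ m / P) (A := 2 ^ n) (by positivity)
    (by positivity) hSc (by exact_mod_cast hWn)
  rw [Real.logb_div (by positivity) (by positivity), Real.logb_mul (by norm_num) (by positivity),
    Real.logb_pow, Real.logb_pow, Real.logb_self_eq_one (by norm_num), ← hx] at hent2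
  -- With L = log P - (m - n) - 1, the entropy bounds give n - h ≤ n + 1 - xL, so xL ≤ h + 1 ≤ L/2.
  have hx2 : x ≤ 1 / 2 := by
    by_contra! hlt
    nlinarith
  -- Outside `S` the acceptance probability is at least 1/2 on the support of `X`. With x ≤ 1/2 the
  -- total is at least 1/4 = 3/16 + 1/16.
  have hsumX : (1 - x) / 2 ≤ ∑ v, (X v).toReal * a v := by
    have h1 : ∀ v, ((X v).toReal - if v ∈ S then (X v).toReal else 0) / 2 ≤
        (X v).toReal * a v := by
      intro v
      by_cases h0 : X v = 0
      · simp [h0]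
      have h2 := hag v h0
      have h3 : 0 ≤ (X v).toReal := ENNReal.toReal_nonneg
      by_cases hv : v ∈ S
      · simp only [hv, if_true, sub_self, zero_div]
        exact mul_nonneg h3 ((hg0 v).trans h2)
      · simp only [hv, if_false, sub_zero]
        have h4 : 1 / 2 ≤ g v := by
          by_contra! hlt
          exact hv (Finset.mem_filter.2 ⟨Finset.mem_univ _, hlt⟩)
        nlinarith
    refine le_trans (le_of_eq ?_) (Finset.sum_le_sum fun v _ => h1 v)
    rw [← Finset.sum_div, Finset.sum_sub_distrib, sum_toReal, Finset.sum_ite_mem,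
      Finset.univ_inter]
  linarith


/-! ### Counting strings of small complexity -/

theorem DescriptionSystem.Emulates.unique {k : ℕ} {U : DescriptionSystem k} {p : List Bool}
    {t : ℕ} {x y : List Bool} (hx : U.Emulates p t x) (hy : U.Emulates p t y) : x = y := by
  obtain ⟨M, w, h1, h2⟩ := hx
  obtain ⟨M', w', h1', h2'⟩ := hy
  rw [h1] at h1'
  obtain ⟨rfl, rfl⟩ := Prod.mk.inj (Option.some.inj h1')
  exact h2.unique h2'

/-- Shortest programs of distinct strings of one length are distinct, because the time bound, and
hence the output of a program, depends only on that length. -/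
theorem card_K_eq_le {k : ℕ} (U : DescriptionSystem k) (t : ℕ → ℕ) (m l : ℕ) :
    (Finset.univ.filter fun y : Fin m → Bool => U.K t (List.ofFn y) = l).card ≤ 2 ^ l := by
  choose p hp using fun y : Fin m → Bool => U.K_attained t (List.ofFn y)
  rw [← Fintype.card_coe, show 2 ^ l = Fintype.card (List.Vector Bool l) by simp]
  refine Fintype.card_le_of_injective
    (fun y => ⟨p y.1, (hp y.1).1.trans (Finset.mem_filter.1 y.2).2⟩) fun y z hyz => ?_
  have h1 := (hp y.1).2
  have h2 := (hp z.1).2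
  rw [Subtype.mk.inj hyz] at h1
  simp only [List.length_ofFn] at h1 h2
  exact Subtype.ext (List.ofFn_injective (h1.unique h2))

theorem card_K_le {k : ℕ} (U : DescriptionSystem k) (t : ℕ → ℕ) (m l : ℕ) :
    (Finset.univ.filter fun y : Fin m → Bool => U.K t (List.ofFn y) ≤ l).card ≤ 2 ^ (l + 1) := by
  induction l with
  | zero =>
    simp only [Nat.le_zero]
    exact (card_K_eq_le U t m 0).trans (by norm_num)
  | succ l ih =>
    have hsub : (Finset.univ.filter fun y : Fin m → Bool => U.K t (List.ofFn y) ≤ l + 1) ⊆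
        (Finset.univ.filter fun y : Fin m → Bool => U.K t (List.ofFn y) ≤ l) ∪
        (Finset.univ.filter fun y : Fin m → Bool => U.K t (List.ofFn y) = l + 1) := by
      intro y hy
      simp only [Finset.mem_union, Finset.mem_filter, Finset.mem_univ, true_and] at hy ⊢
      omega
    refine (Finset.card_le_card hsub).trans ((Finset.card_union_le _ _).trans ?_)
    have := card_K_eq_le U t m (l + 1)
    rw [pow_succ 2 (l + 1)]
    omega

/-- The threshold machine distinguishes `X` from the uniform distribution with constant advantage,
if `H` approximates the complexity of most strings. -/
theorem accept_gap {k kH : ℕ} (U : DescriptionSystem k) (t : ℕ → ℕ) (H : TM Bool kH)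
    (T : Polynomial ℕ) {D : TM Bool (kH + 3)} {TD : Polynomial ℕ}
    (hD : ∀ (n : ℕ) (y : List Bool), 1 ≤ n → y.length + 1 ≤ 2 * n →
      ∃ t₀, t₀ + T.eval y.length ≤ TD.eval n ∧ ∀ ρ,
        (D.Outputs ρ (pairInput n y) (TD.eval n) [true] ↔
          ∃ z, H.Outputs (fun i => ρ (t₀ + i)) y (T.eval y.length) z ∧
            2 * (binVal z + 1) ≤ n + 1 + y.length))
    {n m c : ℕ} {b : ℝ} (X : PMF (Fin m → Bool)) (W : Finset (Fin m → Bool)) (hn : 1 ≤ n)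
    (hm : m + 1 ≤ 2 * n) (hc : 3 ≤ c) (hb0 : 0 ≤ b)
    (hb : 2 * ((n : ℝ) + c + b + 1) ≤ n + 1 + m) (hXW : ∀ y, X y ≠ 0 → y ∈ W)
    (hXK : ∀ y, X y ≠ 0 → U.K t (List.ofFn y) ≤ n + c) (hWn : W.card ≤ 2 ^ n)
    {P : ℝ} (hP : 16 ≤ P) (hsum : 1 - 1 / P ≤ approxProb H T (U.K t) b m)
    {h : ℝ} (hent : (n : ℝ) - h ≤ entropy X)
    (hlog1 : 2 * (h + 1) ≤ Real.logb 2 P - (m - n) - 1)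
    (hlog2 : 0 < Real.logb 2 P - (m - n) - 1) :
    1 / 16 ≤ acceptProb D TD n X - acceptProb D TD n (PMF.uniformOfFintype (Fin m → Bool)) := by
  let A : (Fin m → Bool) → (ℕ → Bool) → Prop := fun y ρ =>
    ∃ z, H.Outputs ρ (List.ofFn y) (T.eval m) z ∧ 2 * (binVal z + 1) ≤ n + 1 + m
  have hA : ∀ y, coinProb (TD.eval n)
      (fun ρ => D.Outputs ρ (pairInput n (List.ofFn y)) (TD.eval n) [true]) =
      coinProb (T.eval m) (A y) := by
    intro y
    obtain ⟨t₀, ht₀, h1⟩ := hD n (List.ofFn y) hn (by simpa using hm)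
    simp only [List.length_ofFn] at ht₀ h1
    rw [← coinProb_shift ht₀ (P := A y)]
    · simp only [h1, A]
    · intro ρ σ hρσ
      simp only [A, H.outputs_congr (List.ofFn y) hρσ]
  -- Ensures that the subtraction in `m - c - 1` is not truncated.
  have hcm : n + 2 * c + 1 ≤ m := by
    have : ((n + 2 * c + 1 : ℕ) : ℝ) ≤ m := by push_cast; linarith
    exact_mod_cast this
  have hac : acceptProb D TD n X = ∑ y, (X y).toReal * coinProb (T.eval m) (A y) := by
    simp only [acceptProb, hA]
  have hau : acceptProb D TD n (PMF.uniformOfFintype (Fin m → Bool))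
      = (∑ y, coinProb (T.eval m) (A y)) / 2 ^ m := by
    simp only [acceptProb, hA, Finset.sum_div]
    refine Finset.sum_congr rfl fun y _ => ?_
    simp [div_eq_inv_mul]
  rw [hac, hau]
  refine advantage X _
    (fun y => coinProb (T.eval m) (Approximates H (T.eval m) (U.K t) b (List.ofFn y)))
    (Finset.univ.filter fun y : Fin m → Bool => U.K t (List.ofFn y) ≤ m - c - 1) W
    (fun y => coinProb_le_one _ _) (fun y => coinProb_nonneg _ _) (fun y => coinProb_le_one _ _)
    hXW (fun y hy => coinProb_mono _ ?_) (fun y hy => coinProb_add_le_one _ ?_) (by simp) hWn ?_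
    hP hsum hent hlog1 hlog2
  · rintro ρ ⟨z, hz, hzb⟩
    refine ⟨z, hz, ?_⟩
    have h1 : (U.K t (List.ofFn y) : ℝ) ≤ n + c := by exact_mod_cast hXK y hy
    have h2 := (abs_le.1 hzb).2
    have : ((2 * (binVal z + 1) : ℕ) : ℝ) ≤ ((n + 1 + m : ℕ) : ℝ) := by push_cast; linarith
    exact_mod_cast this
  -- A run that both accepts and approximates would give complexity at most m - c - 1, so the string
  -- would be in the excluded set.
  · rintro ρ ⟨z, hz, hzn⟩ ⟨z', hz', hzb⟩
    obtain rfl := hz.unique hz'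
    refine hy (Finset.mem_filter.2 ⟨Finset.mem_univ _, ?_⟩)
    have h1 : ((2 * (binVal z + 1) : ℕ) : ℝ) ≤ ((n + 1 + m : ℕ) : ℝ) := by exact_mod_cast hzn
    have h2 := (abs_le.1 hzb).1
    have : ((U.K t (List.ofFn y) + c + 1 : ℕ) : ℝ) ≤ m := by push_cast at h1 ⊢; linarith
    have : U.K t (List.ofFn y) + c + 1 ≤ m := by exact_mod_cast this
    omega
  -- At most 2^(m - c) strings are this simple; c ≥ 3 makes this an eighth of all.
  · have h1 := card_K_le U t m (m - c - 1)
    have h2 : 2 ^ (m - c - 1 + 1) * 8 ≤ 2 ^ m := by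
      rw [show 8 = 2 ^ 3 by norm_num, ← pow_add]
      exact Nat.pow_le_pow_right (by norm_num) (by omega)
    rw [le_div_iff₀ (by norm_num)]
    exact_mod_cast (Nat.mul_le_mul_right 8 h1).trans h2


open Filter Topology

/-! ### Asymptotics -/

theorem tendsto_logb_natCast : Tendsto (fun n : ℕ => Real.logb 2 n) atTop atTop :=
  (Real.tendsto_logb_atTop (by norm_num)).comp tendsto_natCast_atTop_atTop

theorem eventually_logb_le (a b : ℝ) {c : ℝ} (hc : 0 < c) :
    ∀ᶠ n : ℕ in atTop, a * Real.logb 2 n + b ≤ c * n := by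
  have h1 : (fun x : ℝ => a * Real.logb 2 x + b) =o[atTop] (fun x : ℝ => x) := by
    refine Asymptotics.IsLittleO.add ?_ ?_
    · have : (fun x : ℝ => a * Real.logb 2 x) = fun x => (a / Real.log 2) * Real.log x := by
        funext x
        rw [Real.logb]
        ring
      rw [this]
      exact Real.isLittleO_log_id_atTop.const_mul_left _
    · exact Asymptotics.isLittleO_const_id_atTop b
  have h2 := tendsto_natCast_atTop_atTop.eventually (h1.bound hc)
  filter_upwards [h2] with n hn
  rw [Real.norm_eq_abs, Real.norm_eq_abs, Nat.abs_cast] at hn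
  exact (le_abs_self _).trans hn

theorem eventually_rpow_le (C : ℝ) {a ε : ℝ} (ha : a < 1) (hε : 0 < ε) :
    ∀ᶠ n : ℕ in atTop, C * (n : ℝ) ^ a ≤ ε * n := by
  have h1 : Tendsto (fun n : ℕ => C * (n : ℝ) ^ (-(1 - a))) atTop (𝓝 (C * 0)) :=
    ((tendsto_rpow_neg_atTop (by linarith)).comp tendsto_natCast_atTop_atTop).const_mul C
  rw [mul_zero] at h1
  filter_upwards [h1.eventually (gt_mem_nhds hε), eventually_gt_atTop 0] with n hn hn0
  have hn0' : (0 : ℝ) < n := by exact_mod_cast hn0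
  have : (n : ℝ) ^ a = (n : ℝ) ^ (-(1 - a)) * n := by
    rw [← Real.rpow_add_one hn0'.ne']
    congr 1
    ring
  rw [this, ← mul_assoc]
  gcongr

theorem logb_natCast_mono {a b : ℕ} (h : a ≤ b) : Real.logb 2 a ≤ Real.logb 2 b := by
  rcases Nat.eq_zero_or_pos a with rfl | ha
  · rcases Nat.eq_zero_or_pos b with rfl | hb
    · exact le_rfl
    · simpa using Real.logb_nonneg (b := 2) (by norm_num) (by exact_mod_cast hb)
  · exact Real.logb_le_logb_of_le (by norm_num) (by exact_mod_cast ha) (by exact_mod_cast h)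

theorem logb_natCast_nonneg (n : ℕ) : 0 ≤ Real.logb 2 n := by
  simpa using logb_natCast_mono n.zero_le

theorem outLen_mono {γ : ℝ} (hγ : 0 ≤ γ) : Monotone (outLen γ) := fun a b h =>
  add_le_add h (Nat.floor_le_floor (mul_le_mul_of_nonneg_left (logb_natCast_mono h) hγ))

/-! ### Hardness at the output lengths of one generator -/

/-- The hypothesis on `K`, for one output length: no machine approximates it too well. -/
theorem eventually_approxProb_lt {k : ℕ} (U : DescriptionSystem k) {γ d ε : ℝ} (hd : 0 < d)
    (hε : 0 < ε) (hγ : 4 * d + 2 ≤ γ) {t : ℕ → ℕ} (ht : ∀ m : ℕ, ⌊(1 + ε) * (m : ℝ)⌋₊ ≤ t m)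
    {G : (n : ℕ) → (Fin n → Bool) → (Fin (outLen γ n) → Bool)} (hG : RateOneEfficient k G)
    (hG' : IsCondEPPRG (fun n => 1 / (n : ℝ) ^ 2) γ G) :
    ∃ e₀ : ℕ, ∀ e ≥ e₀, ∀ (kH : ℕ) (H : TM Bool kH) (T : Polynomial ℕ), RunsInTime H T →
      ∀ᶠ n : ℕ in atTop, approxProb H T (U.K t) (d * Real.logb 2 (outLen γ n : ℕ)) (outLen γ n)
        < 1 - 1 / ((outLen γ n : ℝ) + 1) ^ e := by
  obtain ⟨M, T₀, hM, C, a, ha, hT₀⟩ := hG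
  obtain ⟨-, E, hE, α, hind, N₀, hent⟩ := hG'
  obtain ⟨c₀, hc₀⟩ := U.universal M
  -- The entropy argument needs log P ≥ (m - n) + 2(α log n + 1) + 1, where m - n ≤ γ log n and log
  -- n ≥ 1. The exponent is chosen before `H`.
  obtain ⟨e₀, he₀⟩ := exists_nat_ge (γ + 2 * |α| + 3)
  refine ⟨e₀ + 1, fun e he kH H T hT => ?_⟩
  obtain ⟨D, TD, hDT, hD⟩ := exists_threshold_machine H T hT
  obtain ⟨N₁, hN₁⟩ := hind _ D TD hDT
  set c := c₀ + 3 with hc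
  filter_upwards [eventually_ge_atTop N₀, eventually_ge_atTop N₁, eventually_ge_atTop 16,
    eventually_logb_le γ 1 one_pos, eventually_rpow_le C ha hε,
    tendsto_logb_natCast.eventually_ge_atTop (c + d + 1)] with n hn0 hn1 hn16 hlen hrate hlog
  by_contra! hcon
  set m := outLen γ n with hm
  have hlog1 : 1 ≤ Real.logb 2 n := by
    have : (0 : ℝ) ≤ c := Nat.cast_nonneg c
    linarith
  have hn16' : (16 : ℝ) ≤ n := by exact_mod_cast hn16
  have hγ0 : 0 ≤ γ * Real.logb 2 n := by
    have : 0 ≤ γ := by linarith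
    positivity
  have hmle : (m : ℝ) ≤ n + γ * Real.logb 2 n := by
    have := Nat.floor_le hγ0
    simp only [hm, outLen, Nat.cast_add]
    linarith
  have hmge : (n : ℝ) + γ * Real.logb 2 n - 1 < m := by
    have := Nat.lt_floor_add_one (γ * Real.logb 2 n)
    simp only [hm, outLen, Nat.cast_add]
    linarith
  have hnm : n ≤ m := Nat.le_add_right _ _
  have hm2 : m + 1 ≤ 2 * n := by
    have : ((m + 1 : ℕ) : ℝ) ≤ ((2 * n : ℕ) : ℝ) := by push_cast; linarith
    exact_mod_cast this
  have hlogm : Real.logb 2 m ≤ 1 + Real.logb 2 n := by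
    have h1 := logb_natCast_mono (show m ≤ 2 * n by omega)
    rwa [Nat.cast_mul, Nat.cast_ofNat, Real.logb_mul (by norm_num) (by positivity),
      Real.logb_self_eq_one (by norm_num)] at h1
  have hlogP : (e : ℝ) * Real.logb 2 n ≤ Real.logb 2 (((m : ℝ) + 1) ^ e) := by
    rw [Real.logb_pow]
    refine mul_le_mul_of_nonneg_left ?_ (Nat.cast_nonneg e)
    have := logb_natCast_mono (show n ≤ m + 1 by omega)
    rwa [Nat.cast_add_one] at this
  have he' : γ + 2 * |α| + 3 ≤ e := he₀.trans (by exact_mod_cast (by omega : e₀ ≤ e))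
  have hprod : (γ + 2 * |α| + 3) * Real.logb 2 n ≤ e * Real.logb 2 n := by gcongr
  have hα : α * Real.logb 2 n ≤ |α| * Real.logb 2 n := by
    gcongr
    exact le_abs_self α
  have hα0 : 0 ≤ |α| * Real.logb 2 n := by positivity
  have hP16 : (16 : ℝ) ≤ ((m : ℝ) + 1) ^ e := by
    have h1 : (1 : ℝ) ≤ (m : ℝ) + 1 := by linarith [Nat.cast_nonneg (α := ℝ) m]
    have h2 : ((m : ℝ) + 1) ^ 1 ≤ ((m : ℝ) + 1) ^ e := pow_le_pow_right₀ h1 (by omega)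
    have h3 : (n : ℝ) ≤ m := by exact_mod_cast hnm
    linarith
  have hdlog : d * Real.logb 2 m ≤ d * (1 + Real.logb 2 n) := by gcongr
  have hγlog : (4 * d + 2) * Real.logb 2 n ≤ γ * Real.logb 2 n := by gcongr
  have hdn : 0 ≤ d * Real.logb 2 n := by positivity
  have himg : ∀ y, ((PMF.uniformOfFinset (E n) (hE n)).map (G n)) y ≠ 0 → ∃ s, G n s = y := by
    intro y hy
    rw [← PMF.mem_support_iff, PMF.mem_support_map_iff] at hy
    obtain ⟨s, -, hs⟩ := hy
    exact ⟨s, hs⟩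
  have hK : ∀ s, U.K t (List.ofFn (G n s)) ≤ n + c := by
    intro s
    obtain ⟨p, hp, hpl⟩ := hc₀ (List.ofFn s)
    rw [List.length_ofFn] at hpl
    have h1 : U.K t (List.ofFn (G n s)) ≤ p.length := by
      refine Nat.sInf_le ⟨p, rfl, M, List.ofFn s, hp, (hM n s).mono ?_⟩
      rw [List.length_ofFn]
      -- Rate-1 efficiency enters here: n + C n^a ≤ (1 + ε)n for large n, and n ≤ m.
      refine le_trans (Nat.le_floor ?_) (ht m)
      have h2 := hT₀ n (by omega)
      have h3 : (1 + ε) * (n : ℝ) ≤ (1 + ε) * m := by gcongr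
      linarith
    omega
  have hadv := accept_gap U t H T hD ((PMF.uniformOfFinset (E n) (hE n)).map (G n))
    (Finset.univ.image (G n)) (by omega) hm2 (show 3 ≤ c by omega)
    (mul_nonneg hd.le (logb_natCast_nonneg m)) (by linarith)
    (fun y hy => by obtain ⟨s, rfl⟩ := himg y hy; simp)
    (fun y hy => by obtain ⟨s, rfl⟩ := himg y hy; exact hK s)
    (Finset.card_image_le.trans (by simp)) hP16 hcon (hent n hn0) (by linarith) (by linarith)
  have h1 := (le_abs_self _).trans_lt (hN₁ n hn1)
  -- The allowed advantage is below the constant 1/16.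
  have h2 : (1 : ℝ) / (n : ℝ) ^ 2 ≤ 1 / 16 ^ 2 := by gcongr
  have h3 := h1.trans_le h2
  norm_num at h3 hadv
  linarith

/-! ### Which lengths are output lengths -/

/-- A large number is an output length for stretch `γ`, or it lies just below a power of
`2 ^ (1 / γ)`, shifted by the exponent. -/
theorem exists_outLen_or_gap {γ : ℝ} (hγ : 0 < γ) : ∀ᶠ m : ℕ in atTop,
    (∃ n, outLen γ n = m) ∨ ∃ n j : ℕ, m = n + j ∧ 1 ≤ j ∧ 1 ≤ n ∧
      γ * Real.logb 2 n < j ∧ (j : ℝ) ≤ γ * Real.logb 2 (n + 1 : ℕ) := by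
  obtain ⟨n₀, hn₀⟩ : ∃ n₀ : ℕ, γ / Real.log 2 ≤ n₀ := exists_nat_ge _
  filter_upwards [eventually_ge_atTop (outLen γ (n₀ + 1))] with m hm
  by_cases hex : ∃ n, outLen γ n = m
  · exact .inl hex
  right
  have hub : ∃ n, m < outLen γ n := ⟨m + 1, by simp only [outLen]; omega⟩
  classical
  have h1 := Nat.find_spec hub
  have h2 : ∀ j < Nat.find hub, ¬ m < outLen γ j := fun j hj => Nat.find_min hub hj
  have h3 : n₀ + 1 < Nat.find hub := by
    by_contra! hle
    exact absurd (h1.trans_le (outLen_mono hγ.le hle)) (by omega)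
  obtain ⟨n, hn⟩ : ∃ n, Nat.find hub = n + 1 := ⟨Nat.find hub - 1, by omega⟩
  rw [hn] at h1 h2 h3
  have h4 : outLen γ n < m :=
    lt_of_le_of_ne (by simpa using h2 n n.lt_succ_self) fun h => hex ⟨n, h⟩
  have hn0 : (0 : ℝ) < n := by exact_mod_cast (by omega : 0 < n)
  -- Once n ≥ γ / ln 2 the floor grows by at most 1 per step, so consecutive output lengths differ
  -- by at most 2 and a skipped `m` is the single number between two of them.
  have hstep : γ * Real.logb 2 (n + 1 : ℕ) ≤ γ * Real.logb 2 n + 1 := by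
    have h5 : Real.log ((n + 1 : ℕ) / n) ≤ (n + 1 : ℕ) / n - 1 :=
      Real.log_le_sub_one_of_pos (by positivity)
    rw [Real.log_div (by positivity) (by positivity)] at h5
    have h6 : ((n + 1 : ℕ) : ℝ) / n - 1 = 1 / n := by
      push_cast
      field_simp
      ring
    have hl2 : 0 < Real.log 2 := Real.log_pos (by norm_num)
    have h7 : γ / Real.log 2 * (1 / n) ≤ 1 := by
      rw [mul_one_div, div_le_one hn0]
      exact hn₀.trans (by exact_mod_cast (by omega : n₀ ≤ n))
    have h8 : γ / Real.log 2 * (Real.log (n + 1 : ℕ) - Real.log n) ≤ γ / Real.log 2 * (1 / n) := by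
      gcongr
      linarith
    have h9 : γ * Real.logb 2 (n + 1 : ℕ) = γ * Real.logb 2 n +
        γ / Real.log 2 * (Real.log (n + 1 : ℕ) - Real.log n) := by
      simp only [Real.logb]
      ring
    linarith
  have hnn : ∀ n : ℕ, 0 ≤ γ * Real.logb 2 n := fun n => mul_nonneg hγ.le (logb_natCast_nonneg n)
  have hfl : ⌊γ * Real.logb 2 (n + 1 : ℕ)⌋₊ ≤ ⌊γ * Real.logb 2 n⌋₊ + 1 := by
    rw [← Nat.floor_add_one (hnn n)]
    exact Nat.floor_le_floor hstep
  simp only [outLen] at h1 h4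
  refine ⟨n, ⌊γ * Real.logb 2 n⌋₊ + 1, by omega, by omega, by omega, ?_, ?_⟩
  · exact_mod_cast Nat.lt_floor_add_one _
  · have h5 : ⌊γ * Real.logb 2 n⌋₊ + 1 ≤ ⌊γ * Real.logb 2 (n + 1 : ℕ)⌋₊ := by omega
    exact le_trans (by exact_mod_cast h5) (Nat.floor_le (hnn _))

theorem rpow_mul_lt_of_logb {γ : ℝ} {x y : ℝ} (hx : 0 < x) (hy : 0 < y)
    (h : Real.logb 2 x ≤ Real.logb 2 y - γ) : x ≤ 2 ^ (-γ) * y := by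
  rw [← Real.logb_le_logb (b := 2) (by norm_num) hx (by positivity),
    Real.logb_mul (by positivity) hy.ne', Real.logb_rpow (by norm_num) (by norm_num)]
  linarith

/-- Every large number is an output length for one of the stretches `γ` and `2γ`. -/
theorem exists_outLen {γ : ℝ} (hγ : 0 < γ) : ∀ᶠ m : ℕ in atTop,
    (∃ n, outLen γ n = m) ∨ ∃ n, outLen (2 * γ) n = m := by
  set r : ℝ := 2 ^ (-(1 / (2 * γ))) with hr
  have hr1 : r < 1 := Real.rpow_lt_one_of_one_lt_of_neg (by norm_num) (by
    rw [neg_lt_zero]; positivity)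
  have hr0 : 0 < r := by positivity
  have hlarge := (tendsto_add_atTop_nat 1).eventually
    (eventually_logb_le (2 * γ) 2 (show 0 < 1 - r by linarith))
  filter_upwards [exists_outLen_or_gap hγ, exists_outLen_or_gap (show 0 < 2 * γ by positivity),
    hlarge] with m h1 h2 hm
  rcases h1 with h1 | ⟨n₁, j₁, hm₁, hj₁, hn₁, hlo₁, hhi₁⟩
  · exact .inl h1
  rcases h2 with h2 | ⟨n₂, j₂, hm₂, hj₂, hn₂, hlo₂, hhi₂⟩
  · exact .inr h2
  exfalso
  have hlog : ∀ n, n ≤ m → Real.logb 2 (n + 1 : ℕ) ≤ Real.logb 2 (m + 1 : ℕ) :=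
    fun n h => logb_natCast_mono (by omega)
  have hb₁ : (j₁ : ℝ) ≤ 2 * γ * Real.logb 2 (m + 1 : ℕ) := by
    have h3 := mul_le_mul_of_nonneg_left (hlog n₁ (by omega)) hγ.le
    have h4 := mul_nonneg hγ.le (logb_natCast_nonneg (m + 1))
    linarith
  have hb₂ : (j₂ : ℝ) ≤ 2 * γ * Real.logb 2 (m + 1 : ℕ) :=
    hhi₂.trans (mul_le_mul_of_nonneg_left (hlog n₂ (by omega)) (by positivity))
  have hmr₁ : (m : ℝ) = n₁ + j₁ := by exact_mod_cast hm₁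
  have hmr₂ : (m : ℝ) = n₂ + j₂ := by exact_mod_cast hm₂
  -- A gap of 1 between the two logarithmic terms makes `a` smaller than `b + 1` by the constant
  -- factor `r`, which is impossible for a number within O(log m) of `m`.
  have key : ∀ a b : ℕ, 1 ≤ a → b ≤ m → (m : ℝ) - a ≤ 2 * γ * Real.logb 2 (m + 1 : ℕ) →
      ¬ (2 * γ * Real.logb 2 a + 1 ≤ 2 * γ * Real.logb 2 (b + 1 : ℕ)) := by
    intro a b ha hb hma h3
    have ha0 : (0 : ℝ) < a := by exact_mod_cast ha
    have h4 : Real.logb 2 a ≤ Real.logb 2 (b + 1 : ℕ) - 1 / (2 * γ) := by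
      rw [le_sub_iff_add_le]
      refine le_of_mul_le_mul_left ?_ (show 0 < 2 * γ by positivity)
      rw [mul_add, mul_one_div_cancel (by positivity)]
      exact h3
    have h5 := rpow_mul_lt_of_logb ha0 (by positivity) h4
    have h6 : r * ((b + 1 : ℕ) : ℝ) ≤ r * ((m + 1 : ℕ) : ℝ) := by gcongr
    push_cast at hm h5 h6 hma
    rw [← hr] at h5
    linarith
  -- If both stretches skip `m`, then 2γ log n₁ is just below 2j₁ and 2γ log n₂ just below j₂;
  -- distinct integers would give the gap excluded by `key`.
  have h3 : j₂ = 2 * j₁ := by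
    by_contra hne
    rcases lt_or_gt_of_ne hne with hlt | hgt
    · refine key n₂ n₁ hn₂ (by omega) (by linarith) ?_
      have : (j₂ : ℝ) + 1 ≤ 2 * j₁ := by exact_mod_cast hlt
      linarith
    · refine key n₁ n₂ hn₁ (by omega) (by linarith) ?_
      have : 2 * (j₁ : ℝ) + 1 ≤ j₂ := by exact_mod_cast hgt
      linarith
  -- Equality fails too: n₂ = n₁ - j₁ gives j₂ ≤ 2γ log(n₂ + 1) ≤ 2γ log n₁ < 2j₁.
  have h4 : n₂ < n₁ := by omega
  have h5 : Real.logb 2 (n₂ + 1 : ℕ) ≤ Real.logb 2 n₁ := logb_natCast_mono h4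
  have h6 := mul_le_mul_of_nonneg_left h5 hγ.le
  rw [h3] at hhi₂
  push_cast at hhi₂ h6
  linarith

end CondEP

/-! ### Hardness at all lengths, from two stretches -/

open Filter in
theorem mainTheorem3 (k : ℕ) (U : CondEP.DescriptionSystem k)
    (hG : ∀ γ : ℚ, 1 < γ →
      ∃ G : (n : ℕ) → (Fin n → Bool) → (Fin (CondEP.outLen (γ : ℝ) n) → Bool),
        CondEP.RateOneEfficient k G ∧
        CondEP.IsCondEPPRG (fun n => 1 / (n : ℝ) ^ 2) (γ : ℝ) G)
    (d ε : ℝ) (hd : 0 < d) (hε : 0 < ε)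
    (t : Polynomial ℝ) (ht : ∀ n : ℕ, (1 + ε) * (n : ℝ) ≤ t.eval (n : ℝ)) :
    CondEP.MildlyHoAToApprox (U.K (fun n => ⌊t.eval (n : ℝ)⌋₊))
      (fun n => d * Real.logb 2 n) := by
  obtain ⟨g, hg⟩ := exists_nat_ge (4 * d + 2)
  have hg2 : (2 : ℝ) < g := by linarith
  have hg1 : 1 < (g : ℚ) := by
    have : 2 < g := by exact_mod_cast hg2
    exact_mod_cast (by omega : 1 < g)
  have ht' : ∀ m : ℕ, ⌊(1 + ε) * (m : ℝ)⌋₊ ≤ ⌊t.eval (m : ℝ)⌋₊ := fun m =>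
    Nat.floor_le_floor (ht m)
  have hmain : ∀ γ : ℚ, (g : ℚ) ≤ γ → ∃ e₀ : ℕ, ∀ e ≥ e₀, ∀ (kH : ℕ) (H : CondEP.TM Bool kH)
      (T : Polynomial ℕ), CondEP.RunsInTime H T → ∀ᶠ n : ℕ in atTop,
        CondEP.approxProb H T (U.K fun n => ⌊t.eval (n : ℝ)⌋₊)
          (d * Real.logb 2 (CondEP.outLen γ n : ℕ)) (CondEP.outLen γ n)
        < 1 - 1 / ((CondEP.outLen γ n : ℝ) + 1) ^ e := by
    intro γ hγ
    obtain ⟨G, hG₁, hG₂⟩ := hG γ (hg1.trans_le hγ)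
    have hγ' : (g : ℝ) ≤ γ := by exact_mod_cast hγ
    exact CondEP.eventually_approxProb_lt U hd hε (hg.trans hγ') ht' hG₁ hG₂
  obtain ⟨e₁, he₁⟩ := hmain g le_rfl
  obtain ⟨e₂, he₂⟩ := hmain (2 * g) (by linarith)
  push_cast at he₁ he₂
  -- The summand 1 keeps the polynomial positive at 0; the larger exponent serves both stretches.
  refine ⟨(Polynomial.X + 1) ^ (max e₁ e₂), fun n => ?_, fun kH H T hT => ?_⟩
  · simp only [Polynomial.eval_pow, Polynomial.eval_add, Polynomial.eval_X, Polynomial.eval_one]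
    positivity
  obtain ⟨N₁, hN₁⟩ := eventually_atTop.1 (he₁ (max e₁ e₂) (le_max_left _ _) kH H T hT)
  obtain ⟨N₂, hN₂⟩ := eventually_atTop.1 (he₂ (max e₁ e₂) (le_max_right _ _) kH H T hT)
  have hlt : ∀ {γ : ℝ}, 0 ≤ γ → ∀ {n N : ℕ}, CondEP.outLen γ N < CondEP.outLen γ n → N ≤ n :=
    fun hγ n N h => by
      by_contra! hle
      exact absurd (CondEP.outLen_mono hγ hle.le) (by omega)
  have hg0 : (0 : ℝ) ≤ g := by linarith
  rw [← eventually_atTop]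
  filter_upwards [CondEP.exists_outLen (show (0 : ℝ) < g by linarith),
    eventually_gt_atTop (CondEP.outLen g N₁), eventually_gt_atTop (CondEP.outLen (2 * g) N₂)]
    with m hm hm₁ hm₂
  simp only [Polynomial.eval_pow, Polynomial.eval_add, Polynomial.eval_X, Polynomial.eval_one]
  rcases hm with ⟨n, rfl⟩ | ⟨n, rfl⟩
  · exact hN₁ n (hlt hg0 hm₁)
  · exact hN₂ n (hlt (by linarith) hm₂)
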